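/- Let $d\ge 2$, $I=[0,1]$, and let $\bar f\in H^5(I;\mathbb R^d)$ be a regular curve, i.e. $\bar f_x(x)\neq 0$ for all $x\in I$. Write $ds=|\bar f_x|\,dx$, $\partial_s=\frac1{|\bar f_x|}\partial_x$ (in the weak sense), and, for a vector field $\phi:I\to\mathbb R^d$, $$\nabla_s\phi=\partial_s\phi-\langle\partial_s\phi,\partial_s\bar f\rangle\,\partial_s\bar f .$$ Let $H^k(ds)$ be the space of $\phi\in L^2(I,ds;\mathbb R^d)$ with weak derivatives $\partial_s^i\phi\in L^2(ds)$, $i\le k$, with norm $\|\phi\|_{H^k(ds)}=\sum_{i=0}^k\|\partial_s^i\phi\|_{L^2(ds)}$, let $H^2_0(ds)$ be the closure of $C_c^\infty((0,1);\mathbb R^d)$ in $H^2(ds)$, and put $$L^{2,\perp}(ds)=\{\phi\in L^2(ds): \langle\phi,\bar f_x\rangle=0 \text{ a.e. on } I\},$$ $$H^{4,\perp}_c(ds)=\{\phi\in H^4(ds)\cap H^2_0(ds): \langle\phi,\bar f_x\rangle=0 \text{ on } I\},$$ the latter with the norm of $H^4(ds)$. Then $\nabla_s^4$ is a well-defined bounded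 linear operator $$\nabla_s^4: H^{4,\perp}_c(ds)\to L^{2,\perp}(ds),$$ and it is Fredholm of index $0$: its kernel is finite dimensional, its range is closed and of finite codimension, and $\dim\ker\nabla_s^4=\operatorname{codim}\operatorname{ran}\nabla_s^4$. -/

import Mathlib

open MeasureTheory Set
open scoped ContDiff

noncomputable section

namespace ElasticCurve

variable {d : ℕ}

/-- Smooth vector fields with compact support in the open interval `(0,1)`. -/
def IsTestField (η : ℝ → EuclideanSpace ℝ (Fin d)) : Prop :=
  ContDiff ℝ ∞ η ∧ HasCompactSupport η ∧ tsupport η ⊆ Ioo (0 : ℝ) 1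

/-- `v` is the weak derivative of `u` on `(0,1)` with respect to `dx`. -/
def HasWeakDerivDx (u v : ℝ → EuclideanSpace ℝ (Fin d)) : Prop :=
  ∀ η : ℝ → EuclideanSpace ℝ (Fin d), IsTestField η →
    ∫ x in Icc (0 : ℝ) 1, inner ℝ (u x) (deriv η x) =
      -∫ x in Icc (0 : ℝ) 1, inner ℝ (v x) (η x)

/-- `f ∈ H^k(I; ℝ^d)`, `I = [0,1]`: `f` is square integrable with square integrable weak
derivatives up to order `k`. -/
def MemSobolev (k : ℕ) (f : ℝ → EuclideanSpace ℝ (Fin d)) : Prop :=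
  ∃ g : ℕ → ℝ → EuclideanSpace ℝ (Fin d), g 0 = f ∧
    (∀ i ≤ k, MemLp (g i) 2 (volume.restrict (Icc (0 : ℝ) 1))) ∧
    ∀ i < k, HasWeakDerivDx (g i) (g (i + 1))

/-- The derivative `f_x` on `I = [0,1]` (one-sided at the end points). -/
def velocity (f : ℝ → EuclideanSpace ℝ (Fin d)) (x : ℝ) : EuclideanSpace ℝ (Fin d) :=
  derivWithin f (Icc (0 : ℝ) 1) x

/-- A regular curve of class `H^k` (used for `k ≥ 2`). As usual, `f` is its continuous
representative, which is then continuously differentiable on `I`; `f_x` has no zero on `I`. -/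
structure IsRegularCurve (k : ℕ) (f : ℝ → EuclideanSpace ℝ (Fin d)) : Prop where
  continuousOn : ContinuousOn f (Icc (0 : ℝ) 1)
  memSobolev : MemSobolev k f
  velocity_ne_zero : ∀ x ∈ Icc (0 : ℝ) 1, velocity f x ≠ 0

/-- The unit tangent `∂_s f = f_x / |f_x|`. -/
def unitTangent (f : ℝ → EuclideanSpace ℝ (Fin d)) (x : ℝ) : EuclideanSpace ℝ (Fin d) :=
  ‖velocity f x‖⁻¹ • velocity f x

/-- The measure `ds_f = |f_x| dx` on `I`. -/
def arcMeasure (f : ℝ → EuclideanSpace ℝ (Fin d)) : Measure ℝ :=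
  (volume.restrict (Icc (0 : ℝ) 1)).withDensity fun x => ENNReal.ofReal ‖velocity f x‖

/-- The Hilbert space `L²(I, ds_f; ℝ^d)`. -/
abbrev L2 (f : ℝ → EuclideanSpace ℝ (Fin d)) : Type :=
  Lp (EuclideanSpace ℝ (Fin d)) 2 (arcMeasure f)

/-- `v = ∂_s u` weakly: `∫ u · ∂_s η ds = - ∫ v · η ds` for all test fields `η`, where
`∂_s η = η_x / |f_x|`. For a regular curve the two integrability clauses hold automatically. -/
def HasWeakDs (f : ℝ → EuclideanSpace ℝ (Fin d)) (u v : L2 f) : Prop :=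
  ∀ η : ℝ → EuclideanSpace ℝ (Fin d), IsTestField η →
    Integrable (fun x => (inner ℝ (u x) (‖velocity f x‖⁻¹ • deriv η x) : ℝ)) (arcMeasure f) ∧
    Integrable (fun x => (inner ℝ (v x) (η x) : ℝ)) (arcMeasure f) ∧
    ∫ x, inner ℝ (u x) (‖velocity f x‖⁻¹ • deriv η x) ∂(arcMeasure f) =
      -∫ x, inner ℝ (v x) (η x) ∂(arcMeasure f)

theorem HasWeakDs.zero (f : ℝ → EuclideanSpace ℝ (Fin d)) : HasWeakDs f 0 0 := by
  intro η _
  have h0 := Lp.coeFn_zero (EuclideanSpace ℝ (Fin d)) 2 (arcMeasure f)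
  have h1 : (fun x => (inner ℝ ((0 : L2 f) x) (‖velocity f x‖⁻¹ • deriv η x) : ℝ))
      =ᵐ[arcMeasure f] fun _ => 0 := by
    filter_upwards [h0] with x hx
    rw [hx, Pi.zero_apply, inner_zero_left]
  have h2 : (fun x => (inner ℝ ((0 : L2 f) x) (η x) : ℝ)) =ᵐ[arcMeasure f] fun _ => 0 := by
    filter_upwards [h0] with x hx
    rw [hx, Pi.zero_apply, inner_zero_left]
  refine ⟨(integrable_zero _ _ _).congr h1.symm, (integrable_zero _ _ _).congr h2.symm, ?_⟩
  rw [integral_congr_ae h1, integral_congr_ae h2]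
  simp

theorem HasWeakDs.add {f : ℝ → EuclideanSpace ℝ (Fin d)} {u v u' v' : L2 f}
    (h : HasWeakDs f u v) (h' : HasWeakDs f u' v') : HasWeakDs f (u + u') (v + v') := by
  intro η hη
  obtain ⟨a, b, c⟩ := h η hη
  obtain ⟨a', b', c'⟩ := h' η hη
  have h1 : (fun x => (inner ℝ ((u + u' : L2 f) x) (‖velocity f x‖⁻¹ • deriv η x) : ℝ))
      =ᵐ[arcMeasure f] fun x => inner ℝ (u x) (‖velocity f x‖⁻¹ • deriv η x) +
        inner ℝ (u' x) (‖velocity f x‖⁻¹ • deriv η x) := by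
    filter_upwards [Lp.coeFn_add u u'] with x hx
    rw [hx, Pi.add_apply, inner_add_left]
  have h2 : (fun x => (inner ℝ ((v + v' : L2 f) x) (η x) : ℝ))
      =ᵐ[arcMeasure f] fun x => inner ℝ (v x) (η x) + inner ℝ (v' x) (η x) := by
    filter_upwards [Lp.coeFn_add v v'] with x hx
    rw [hx, Pi.add_apply, inner_add_left]
  refine ⟨(a.add a').congr h1.symm, (b.add b').congr h2.symm, ?_⟩
  rw [integral_congr_ae h1, integral_congr_ae h2, integral_add a a', integral_add b b', c, c']
  ring

theorem HasWeakDs.smul {f : ℝ → EuclideanSpace ℝ (Fin d)} {u v : L2 f} (r : ℝ)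
    (h : HasWeakDs f u v) : HasWeakDs f (r • u) (r • v) := by
  intro η hη
  obtain ⟨a, b, c⟩ := h η hη
  have h1 : (fun x => (inner ℝ ((r • u : L2 f) x) (‖velocity f x‖⁻¹ • deriv η x) : ℝ))
      =ᵐ[arcMeasure f] fun x => r * inner ℝ (u x) (‖velocity f x‖⁻¹ • deriv η x) := by
    filter_upwards [Lp.coeFn_smul r u] with x hx
    rw [hx, Pi.smul_apply, real_inner_smul_left]
  have h2 : (fun x => (inner ℝ ((r • v : L2 f) x) (η x) : ℝ))
      =ᵐ[arcMeasure f] fun x => r * inner ℝ (v x) (η x) := by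
    filter_upwards [Lp.coeFn_smul r v] with x hx
    rw [hx, Pi.smul_apply, real_inner_smul_left]
  refine ⟨(a.const_mul r).congr h1.symm, (b.const_mul r).congr h2.symm, ?_⟩
  rw [integral_congr_ae h1, integral_congr_ae h2, integral_const_mul, integral_const_mul, c]
  ring

/-- The Sobolev space `H^k(I, ds_f; ℝ^d)`. An element is a field `φ ∈ L²(ds_f)` recorded with its
weak derivatives, `u = (φ, ∂_s φ, …, ∂_s^k φ)`, all in `L²(ds_f)`; for a regular curve `u` is
determined by `φ = u 0`. The norm, inherited from the `ℓ¹`-product, is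
`‖φ‖_{H^k(ds_f)} = ∑_{i ≤ k} ‖∂_s^i φ‖_{L²(ds_f)}`. -/
def Sobolev (f : ℝ → EuclideanSpace ℝ (Fin d)) (k : ℕ) :
    Submodule ℝ (PiLp 1 fun _ : Fin (k + 1) => L2 f) where
  carrier := {u | ∀ i : Fin k, HasWeakDs f (u i.castSucc) (u i.succ)}
  zero_mem' := fun _ => HasWeakDs.zero f
  add_mem' := fun hu hv i => (hu i).add (hv i)
  smul_mem' := fun r _ hu i => (hu i).smul r

/-- The linear map `H^k → L²`, `φ ↦ φ`. -/
def Sobolev.toL2 (f : ℝ → EuclideanSpace ℝ (Fin d)) (k : ℕ) : Sobolev f k →ₗ[ℝ] L2 f where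
  toFun u := u.1 0
  map_add' _ _ := rfl
  map_smul' _ _ := rfl

/-- The inclusion `H⁴ ⊆ H²`, `(φ, …, ∂_s⁴ φ) ↦ (φ, ∂_s φ, ∂_s² φ)`. -/
def Sobolev.toH2 (f : ℝ → EuclideanSpace ℝ (Fin d)) : Sobolev f 4 →ₗ[ℝ] Sobolev f 2 where
  toFun u := ⟨WithLp.toLp 1 fun i : Fin 3 => u.1 (i.castLE (by norm_num)),
    fun i => u.2 (i.castLE (by norm_num))⟩
  map_add' _ _ := rfl
  map_smul' _ _ := rfl

theorem IsTestField.zero : IsTestField (0 : ℝ → EuclideanSpace ℝ (Fin d)) := by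
  refine ⟨contDiff_const, HasCompactSupport.zero, ?_⟩
  simp [tsupport]

theorem IsTestField.add {η ζ : ℝ → EuclideanSpace ℝ (Fin d)} (h : IsTestField η)
    (h' : IsTestField ζ) : IsTestField (η + ζ) :=
  ⟨h.1.add h'.1, h.2.1.add h'.2.1, (tsupport_add η ζ).trans (union_subset h.2.2 h'.2.2)⟩

theorem IsTestField.smul {η : ℝ → EuclideanSpace ℝ (Fin d)} (r : ℝ) (h : IsTestField η) :
    IsTestField (r • η) :=
  ⟨h.1.const_smul r, h.2.1.smul_left (f := fun _ => r),
    (tsupport_smul_subset_right (fun _ => r) η).trans h.2.2⟩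

/-- The smooth fields with compact support in `(0,1)`, as a subspace of `H²(ds_f)`. -/
def testFields (f : ℝ → EuclideanSpace ℝ (Fin d)) : Submodule ℝ (Sobolev f 2) where
  carrier := {u | ∃ η : ℝ → EuclideanSpace ℝ (Fin d), IsTestField η ∧
    Sobolev.toL2 f 2 u =ᵐ[arcMeasure f] η}
  zero_mem' := ⟨0, IsTestField.zero, Lp.coeFn_zero _ _ _⟩
  add_mem' := by
    rintro u v ⟨η, hη, hu⟩ ⟨ζ, hζ, hv⟩
    refine ⟨η + ζ, hη.add hζ, ?_⟩
    rw [map_add]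
    exact (Lp.coeFn_add _ _).trans (hu.add hv)
  smul_mem' := by
    rintro r u ⟨η, hη, hu⟩
    refine ⟨r • η, hη.smul r, ?_⟩
    rw [map_smul]
    exact (Lp.coeFn_smul _ _).trans (hu.const_smul r)

/-- `H²₀(ds_f)`: the closure of the test fields in `H²(ds_f)`. -/
def H20 (f : ℝ → EuclideanSpace ℝ (Fin d)) : Submodule ℝ (Sobolev f 2) :=
  (testFields f).topologicalClosure

/-- `L^{2,⊥}(ds_f)`: the fields in `L²(ds_f)` that are normal to the curve. -/
def L2Normal (f : ℝ → EuclideanSpace ℝ (Fin d)) : Submodule ℝ (L2 f) where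
  carrier := {u | ∀ᵐ x ∂(arcMeasure f), (inner ℝ (u x) (velocity f x) : ℝ) = 0}
  zero_mem' := by
    filter_upwards [Lp.coeFn_zero (EuclideanSpace ℝ (Fin d)) 2 (arcMeasure f)] with x hx
    rw [hx, Pi.zero_apply, inner_zero_left]
  add_mem' := by
    intro u v hu hv
    filter_upwards [hu, hv, Lp.coeFn_add u v] with x h1 h2 hx
    rw [hx, Pi.add_apply, inner_add_left, h1, h2, add_zero]
  smul_mem' := by
    intro r u hu
    filter_upwards [hu, Lp.coeFn_smul r u] with x h1 hx
    rw [hx, Pi.smul_apply, real_inner_smul_left, h1, mul_zero]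

/-- `H^{4,⊥}_c(ds_f)`: the normal fields in `H⁴_c(ds_f) = H⁴(ds_f) ∩ H²₀(ds_f)`, with the norm of
`H⁴(ds_f)`. -/
def H4cNormal (f : ℝ → EuclideanSpace ℝ (Fin d)) : Submodule ℝ (Sobolev f 4) :=
  (H20 f).comap (Sobolev.toH2 f) ⊓ (L2Normal f).comap (Sobolev.toL2 f 4)

/-- `ψ = ∇_s φ`, the normal component `∂_s φ - ⟨∂_s φ, ∂_s f⟩ ∂_s f` of the weak derivative. -/
def HasNablaS (f : ℝ → EuclideanSpace ℝ (Fin d)) (φ ψ : L2 f) : Prop :=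
  ∃ v : L2 f, HasWeakDs f φ v ∧
    ψ =ᵐ[arcMeasure f] fun x => v x - (inner ℝ (v x) (unitTangent f x) : ℝ) • unitTangent f x

/-- `ψ = ∇_s^n φ`. -/
def HasIterNablaS (f : ℝ → EuclideanSpace ℝ (Fin d)) : ℕ → L2 f → L2 f → Prop
  | 0, φ, ψ => ψ = φ
  | n + 1, φ, ψ => ∃ χ : L2 f, HasIterNablaS f n φ χ ∧ HasNablaS f χ ψ

/-- The index `dim ker T - codim ran T` of a Fredholm operator. -/
def fredholmIndex {X Y : Type*} [AddCommGroup X] [Module ℝ X] [TopologicalSpace X]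
    [AddCommGroup Y] [Module ℝ Y] [TopologicalSpace Y] (T : X →L[ℝ] Y) : ℤ :=
  (Module.finrank ℝ T.ker : ℤ) - (Module.finrank ℝ (Y ⧸ T.range) : ℤ)

end ElasticCurve

end

/-! The operator is in fact bijective: under clamped boundary conditions both the kernel and the
cokernel vanish, so index `0` comes from `0 - 0`. No compact perturbation argument is needed.

Injectivity is an energy argument. On normal fields `∇_s` is compatible with the metric: the
tangential part removed by the projection is orthogonal to any other normal field. A clamped normal
`φ` satisfies `φ = ∇_s φ = 0` at both end points, so two integrations by parts turn `∇_s⁴ φ = 0`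
into `‖∇_s² φ‖² = 0`. Then `|∇_s φ|²` is constant and zero at the left end, hence `∇_s φ = 0`, and
the same reasoning gives `φ = 0` (`eq_zero_of_iterNablaS_eq_zero`).

Surjectivity trivializes the normal connection. Let `τ` be the unit tangent. Parallel transport `R`
(`exists_parallel_transport`) is a family of linear isometries carrying the complement of `τ(0)` to
the complement of `τ(x)`, with `∇_s (R w) = R ∂_s w` for `w` orthogonal to `τ(0)`. So `∇_s⁴ φ = g`
becomes `∂_s⁴ w = R⁻¹ g` with constant coefficients, solved under clamped conditions by four
integrations and a cubic polynomial in arc length (`exists_clamped_solution`). Since `f` is only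
`H⁵`, `R` has exactly the `H⁴` regularity needed for `φ = R w` to be in `H⁴`
(`exists_iterNablaS_eq`).

Two translations link this to the weak definitions. Weak derivatives are replaced by antiderivatives
(`HasWeakDerivDx.exists_isPrimitive`), and membership in `H²₀` by vanishing of `φ` and `∂_s φ` at
the end points (`boundary_eq_zero`, `mem_H20`). Boundedness of `∇_s : H^{k+1} → H^k` comes from the
closed graph theorem (`exists_nablaS`), and the Fredholm property from the open mapping theorem. -/

namespace ElasticCurve

/-! ### Calculus of antiderivatives of integrable functions on `[0,1]`. -/

section Primitive

variable {E F G : Type*} [NormedAddCommGroup E] [NormedSpace ℝ E]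
  [NormedAddCommGroup F] [NormedSpace ℝ F]
  [NormedAddCommGroup G] [NormedSpace ℝ G]

/-- On `[0,1]`, `u` is an antiderivative of the integrable function `v`. -/
structure IsPrimitive (u v : ℝ → E) : Prop where
  integrableOn : IntegrableOn v (Icc (0 : ℝ) 1)
  eq_add_integral : ∀ x ∈ Icc (0 : ℝ) 1, u x = u 0 + ∫ t in (0 : ℝ)..x, v t

omit [NormedSpace ℝ E] in
theorem intervalIntegrable_of_integrableOn {v : ℝ → E} (hv : IntegrableOn v (Icc (0 : ℝ) 1))
    {x : ℝ} (hx : x ∈ Icc (0 : ℝ) 1) : IntervalIntegrable v volume 0 x := by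
  rw [intervalIntegrable_iff_integrableOn_Icc_of_le hx.1]
  exact hv.mono_set (Icc_subset_Icc_right hx.2)

theorem intervalIntegral_congr_ae_Icc {v w : ℝ → E}
    (h : v =ᵐ[volume.restrict (Icc (0 : ℝ) 1)] w) {x : ℝ} (hx : x ∈ Icc (0 : ℝ) 1) :
    ∫ t in (0 : ℝ)..x, v t = ∫ t in (0 : ℝ)..x, w t := by
  rw [intervalIntegral.integral_of_le hx.1, intervalIntegral.integral_of_le hx.1]
  exact integral_congr_ae (ae_restrict_of_ae_restrict_of_subset
    (Ioc_subset_Icc_self.trans (Icc_subset_Icc_right hx.2)) h)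

theorem isPrimitive_const_add_integral {v : ℝ → E} (hv : IntegrableOn v (Icc (0 : ℝ) 1)) (c : E) :
    IsPrimitive (fun x => c + ∫ t in (0 : ℝ)..x, v t) v :=
  ⟨hv, fun x _ => by simp⟩

theorem isPrimitive_const (c : E) : IsPrimitive (fun _ => c) (fun _ => (0 : E)) :=
  ⟨by simp, fun x _ => by simp⟩

namespace IsPrimitive

variable {u v w z : ℝ → E}

theorem continuousOn (h : IsPrimitive u v) : ContinuousOn u (Icc (0 : ℝ) 1) := by
  have := intervalIntegral.continuousOn_primitive_interval (f := v) (μ := volume) (a := 0) (b := 1)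
    (by rw [uIcc_of_le zero_le_one]; exact h.integrableOn)
  rw [uIcc_of_le zero_le_one] at this
  exact (continuousOn_const.add this).congr h.eq_add_integral

theorem congr_deriv (h : IsPrimitive u v) (hw : v =ᵐ[volume.restrict (Icc (0 : ℝ) 1)] w) :
    IsPrimitive u w :=
  ⟨h.integrableOn.congr hw, fun x hx => by
    rw [h.eq_add_integral x hx, intervalIntegral_congr_ae_Icc hw hx]⟩

theorem congr_left (h : IsPrimitive u v) (hw : EqOn w u (Icc (0 : ℝ) 1)) : IsPrimitive w v :=
  ⟨h.integrableOn, fun x hx => by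
    rw [hw hx, hw (left_mem_Icc.2 zero_le_one), h.eq_add_integral x hx]⟩

theorem add (h : IsPrimitive u v) (h' : IsPrimitive w z) :
    IsPrimitive (fun x => u x + w x) (fun x => v x + z x) :=
  ⟨h.integrableOn.add h'.integrableOn, fun x hx => by
    rw [intervalIntegral.integral_add (intervalIntegrable_of_integrableOn h.integrableOn hx)
      (intervalIntegrable_of_integrableOn h'.integrableOn hx), h.eq_add_integral x hx,
      h'.eq_add_integral x hx]
    abel⟩

theorem clm [CompleteSpace E] [CompleteSpace F] (h : IsPrimitive u v) (A : E →L[ℝ] F) :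
    IsPrimitive (fun x => A (u x)) (fun x => A (v x)) :=
  ⟨A.integrable_comp h.integrableOn, fun x hx => by
    rw [A.intervalIntegral_comp_comm (intervalIntegrable_of_integrableOn h.integrableOn hx),
      h.eq_add_integral x hx, map_add]⟩

theorem integral_eq (h : IsPrimitive u v) : ∫ t in (0 : ℝ)..1, v t = u 1 - u 0 := by
  rw [h.eq_add_integral 1 (by simp)]; abel

theorem setIntegral_eq (h : IsPrimitive u v) : ∫ t in Icc (0 : ℝ) 1, v t = u 1 - u 0 := by
  rw [integral_Icc_eq_integral_Ioc, ← intervalIntegral.integral_of_le zero_le_one, h.integral_eq]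

theorem eqOn_const (h : IsPrimitive u v) (hv : v =ᵐ[volume.restrict (Icc (0 : ℝ) 1)] 0) :
    EqOn u (fun _ => u 0) (Icc (0 : ℝ) 1) := fun x hx => by
  rw [h.eq_add_integral x hx, intervalIntegral_congr_ae_Icc hv hx]; simp

omit [NormedSpace ℝ E] in
theorem eqOn_of_ae_eq (h : ContinuousOn u (Icc (0 : ℝ) 1)) (h' : ContinuousOn w (Icc (0 : ℝ) 1))
    (huw : u =ᵐ[volume.restrict (Icc (0 : ℝ) 1)] w) : EqOn u w (Icc (0 : ℝ) 1) :=
  Measure.eqOn_Icc_of_ae_eq volume zero_ne_one huw h h'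

theorem of_hasDerivAt [CompleteSpace E]
    (h : ∀ x ∈ Icc (0 : ℝ) 1, HasDerivWithinAt u (v x) (Icc 0 1) x)
    (hv : ContinuousOn v (Icc (0 : ℝ) 1)) : IsPrimitive u v := by
  refine ⟨hv.integrableOn_Icc, fun x hx => ?_⟩
  rw [intervalIntegral.integral_eq_sub_of_hasDerivAt_of_le hx.1]
  · abel
  · exact fun y hy => ((h y ⟨hy.1, hy.2.trans hx.2⟩).continuousWithinAt).mono
      (Icc_subset_Icc_right hx.2)
  · exact fun y hy => (h y ⟨hy.1.le, hy.2.le.trans hx.2⟩).hasDerivAt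
      (Icc_mem_nhds hy.1 (hy.2.trans_le hx.2))
  · exact intervalIntegrable_of_integrableOn hv.integrableOn_Icc hx

theorem hasDerivWithinAt [CompleteSpace E] (h : IsPrimitive u v)
    (hv : ContinuousOn v (Icc (0 : ℝ) 1)) {x : ℝ} (hx : x ∈ Icc (0 : ℝ) 1) :
    HasDerivWithinAt u (v x) (Icc 0 1) x := by
  have : Fact (x ∈ Icc (0 : ℝ) 1) := ⟨hx⟩
  have h1 : HasDerivWithinAt (fun y => ∫ t in (0 : ℝ)..y, v t) (v x) (Icc 0 1) x :=
    intervalIntegral.integral_hasDerivWithinAt_right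
      (intervalIntegrable_of_integrableOn h.integrableOn hx)
      (hv.stronglyMeasurableAtFilter_nhdsWithin measurableSet_Icc x) (hv x hx)
  exact (h1.const_add (u 0)).congr h.eq_add_integral (h.eq_add_integral x hx)

end IsPrimitive

/-- Fubini: the left side is the integral of `B (v s) (z t)` over a square. Cutting the square along
its diagonal and integrating each triangle in its inner variable gives the two terms on the right.
Only integrability of `v` and `z` is used. -/
theorem integral_Ioc_bilin_by_parts [CompleteSpace E] [CompleteSpace F] [CompleteSpace G]
    (B : E →L[ℝ] F →L[ℝ] G) {x : ℝ} {v : ℝ → E} {z : ℝ → F}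
    (hv : IntegrableOn v (Ioc 0 x)) (hz : IntegrableOn z (Ioc 0 x)) :
    B (∫ t in Ioc 0 x, v t) (∫ t in Ioc 0 x, z t) =
      ∫ t in Ioc 0 x, (B (v t) (∫ s in Ioc 0 t, z s) + B (∫ s in Ioc 0 t, v s) (z t)) := by
  set m := (volume : Measure ℝ).restrict (Ioc 0 x) with hm
  have hI : Integrable (fun p : ℝ × ℝ => B (v p.1) (z p.2)) (m.prod m) :=
    hv.op_fst_snd (by fun_prop) ⟨‖B‖, B.le_opNorm₂⟩ hz
  let S : Set (ℝ × ℝ) := {p | p.1 ≤ p.2}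
  have hS : MeasurableSet S := measurableSet_le measurable_fst measurable_snd
  have e1 : ∀ᵐ t ∂m, (∫ s, S.indicator (fun p : ℝ × ℝ => B (v p.1) (z p.2)) (s, t) ∂m) =
      B (∫ s in Ioc 0 t, v s) (z t) := by
    filter_upwards [ae_restrict_mem measurableSet_Ioc] with t ht
    have : (fun s => S.indicator (fun p : ℝ × ℝ => B (v p.1) (z p.2)) (s, t)) =
        (Iic t).indicator fun s => B.flip (z t) (v s) := by
      ext s; simp [indicator, S]
    have hst : Iic t ∩ Ioc 0 x = Ioc 0 t := by
      ext s; simp only [mem_inter_iff, mem_Iic, mem_Ioc]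
      exact ⟨fun h => ⟨h.2.1, h.1⟩, fun h => ⟨h.2, h.1, h.2.trans ht.2⟩⟩
    rw [this, integral_indicator measurableSet_Iic, hm, Measure.restrict_restrict measurableSet_Iic,
      hst, ContinuousLinearMap.integral_comp_comm]
    · rfl
    · exact hv.mono_set (Ioc_subset_Ioc_right ht.2)
  have e2 : ∀ᵐ s ∂m, (∫ t, Sᶜ.indicator (fun p : ℝ × ℝ => B (v p.1) (z p.2)) (s, t) ∂m) =
      B (v s) (∫ t in Ioc 0 s, z t) := by
    filter_upwards [ae_restrict_mem measurableSet_Ioc] with t ht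
    have : (fun s => Sᶜ.indicator (fun p : ℝ × ℝ => B (v p.1) (z p.2)) (t, s)) =
        (Iio t).indicator fun s => B (v t) (z s) := by
      ext s; simp [indicator, S]
    have hst : Iio t ∩ Ioc 0 x = Ioo 0 t := by
      ext s; simp only [mem_inter_iff, mem_Iio, mem_Ioc, mem_Ioo]
      exact ⟨fun h => ⟨h.2.1, h.1⟩, fun h => ⟨h.2, h.1, h.2.le.trans ht.2⟩⟩
    rw [this, integral_indicator measurableSet_Iio, hm, Measure.restrict_restrict measurableSet_Iio,
      hst, ← integral_Ioc_eq_integral_Ioo, ContinuousLinearMap.integral_comp_comm]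
    exact hz.mono_set (Ioc_subset_Ioc_right ht.2)
  have i1 := hI.indicator hS
  have i2 := hI.indicator hS.compl
  have j1 := i1.integral_prod_right
  have j2 := i2.integral_prod_left
  rw [← integral_prod_bilin B hv hz, ← integral_add_compl hS hI, ← integral_indicator hS,
    ← integral_indicator hS.compl, integral_prod_symm _ i1, integral_prod _ i2,
    integral_congr_ae e1, integral_congr_ae e2, add_comm, ← integral_add]
  · exact j2.congr e2
  · exact j1.congr e1

/-- The product rule for absolutely continuous functions. Splitting off the initial values `u 0` and
`w 0` leaves terms linear in one factor and the term given by `integral_Ioc_bilin_by_parts`. -/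
theorem IsPrimitive.bilin [CompleteSpace E] [CompleteSpace F] [CompleteSpace G]
    (B : E →L[ℝ] F →L[ℝ] G) {u v : ℝ → E} {w z : ℝ → F}
    (h : IsPrimitive u v) (h' : IsPrimitive w z) :
    IsPrimitive (fun x => B (u x) (w x)) (fun x => B (v x) (w x) + B (u x) (z x)) := by
  obtain ⟨C, hC⟩ := isCompact_Icc.exists_bound_of_continuousOn h.continuousOn
  obtain ⟨D, hD⟩ := isCompact_Icc.exists_bound_of_continuousOn h'.continuousOn
  have i1 : IntegrableOn (fun x => B (v x) (w x)) (Icc 0 1) :=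
    B.integrable_of_bilin_of_bdd_right D h.integrableOn
      (h'.continuousOn.aestronglyMeasurable measurableSet_Icc)
      (by filter_upwards [ae_restrict_mem measurableSet_Icc] with x hx using hD x hx)
  have i2 : IntegrableOn (fun x => B (u x) (z x)) (Icc 0 1) :=
    B.integrable_of_bilin_of_bdd_left C
      (h.continuousOn.aestronglyMeasurable measurableSet_Icc)
      (by filter_upwards [ae_restrict_mem measurableSet_Icc] with x hx using hC x hx)
      h'.integrableOn
  refine ⟨i1.add i2, fun x hx => ?_⟩
  have hsub : Ioc (0 : ℝ) x ⊆ Icc 0 1 := Ioc_subset_Icc_self.trans (Icc_subset_Icc_right hx.2)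
  have hv := h.integrableOn.mono_set hsub
  have hz := h'.integrableOn.mono_set hsub
  have key := integral_Ioc_bilin_by_parts B hv hz
  have e : ∀ t ∈ Ioc (0 : ℝ) x, B (v t) (w t) + B (u t) (z t) =
      (B (v t) (w 0) + B (u 0) (z t)) +
      (B (v t) (∫ s in Ioc 0 t, z s) + B (∫ s in Ioc 0 t, v s) (z t)) := by
    intro t ht
    have h1 := h.eq_add_integral t (hsub ht)
    have h2 := h'.eq_add_integral t (hsub ht)
    rw [intervalIntegral.integral_of_le ht.1.le] at h1 h2
    rw [h1, h2]
    simp only [map_add, add_apply]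
    abel
  have hu := h.eq_add_integral x hx
  have hw := h'.eq_add_integral x hx
  rw [intervalIntegral.integral_of_le hx.1] at hu hw
  have k1 : IntegrableOn (fun t => B (v t) (w 0)) (Ioc 0 x) :=
    (B.flip (w 0)).integrable_comp hv
  have k2 : IntegrableOn (fun t => B (u 0) (z t)) (Ioc 0 x) := (B (u 0)).integrable_comp hz
  have k12 : IntegrableOn (fun t => B (v t) (w 0) + B (u 0) (z t)) (Ioc 0 x) := k1.add k2
  have k3 : IntegrableOn (fun t => B (v t) (∫ s in Ioc 0 t, z s) +
      B (∫ s in Ioc 0 t, v s) (z t)) (Ioc 0 x) := by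
    have : IntegrableOn (fun t => (B (v t) (w t) + B (u t) (z t)) -
      (B (v t) (w 0) + B (u 0) (z t))) (Ioc 0 x) := ((i1.add i2).mono_set hsub).sub (k1.add k2)
    refine this.congr_fun (fun t ht => ?_) measurableSet_Ioc
    dsimp only
    rw [e t ht]; abel
  rw [intervalIntegral.integral_of_le hx.1, setIntegral_congr_fun measurableSet_Ioc e,
    integral_add k12 k3, integral_add k1 k2, ← key, hu, hw]
  have e1 : ∫ t in Ioc 0 x, B (v t) (w 0) = B (∫ t in Ioc 0 x, v t) (w 0) :=
    (B.flip (w 0)).integral_comp_comm hv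
  rw [e1, (B (u 0)).integral_comp_comm hz]
  simp only [map_add, add_apply]
  abel

end Primitive

end ElasticCurve

namespace ElasticCurve

/-! ### Sobolev classes on `[0,1]` described by iterated antiderivatives. -/

section MemH

variable {E F G : Type*} [NormedAddCommGroup E] [NormedSpace ℝ E]
  [NormedAddCommGroup F] [NormedSpace ℝ F]
  [NormedAddCommGroup G] [NormedSpace ℝ G]

/-- `u` agrees almost everywhere on `[0,1]` with a `k`-fold antiderivative of a square integrable
function. -/
def MemH : ℕ → (ℝ → E) → Prop
  | 0, u => MemLp u 2 (volume.restrict (Icc (0 : ℝ) 1))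
  | k + 1, u => ∃ U v : ℝ → E, IsPrimitive U v ∧ MemH k v ∧
      u =ᵐ[volume.restrict (Icc (0 : ℝ) 1)] U

omit [NormedSpace ℝ E] in
theorem memLp_two_of_continuousOn {u : ℝ → E} (hu : ContinuousOn u (Icc (0 : ℝ) 1)) :
    MemLp u 2 (volume.restrict (Icc (0 : ℝ) 1)) := by
  obtain ⟨C, hC⟩ := isCompact_Icc.exists_bound_of_continuousOn hu
  exact MemLp.of_bound (hu.aestronglyMeasurable measurableSet_Icc) C
    (by filter_upwards [ae_restrict_mem measurableSet_Icc] with x hx using hC x hx)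

namespace MemH

theorem congr {k : ℕ} {u w : ℝ → E} (h : MemH k u)
    (huw : u =ᵐ[volume.restrict (Icc (0 : ℝ) 1)] w) : MemH k w := by
  cases k with
  | zero => exact MemLp.ae_eq huw h
  | succ k =>
    obtain ⟨U, v, h1, h2, h3⟩ := h
    exact ⟨U, v, h1, h2, huw.symm.trans h3⟩

theorem memLp {k : ℕ} {u : ℝ → E} (h : MemH k u) :
    MemLp u 2 (volume.restrict (Icc (0 : ℝ) 1)) := by
  cases k with
  | zero => exact h
  | succ k =>
    obtain ⟨U, v, h1, h2, h3⟩ := h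
    exact (memLp_two_of_continuousOn h1.continuousOn).ae_eq h3.symm

theorem integrableOn {k : ℕ} {u : ℝ → E} (h : MemH k u) : IntegrableOn u (Icc (0 : ℝ) 1) :=
  h.memLp.integrable one_le_two

theorem of_succ {k : ℕ} {u : ℝ → E} (h : MemH (k + 1) u) : MemH k u := by
  induction k generalizing u with
  | zero => exact h.memLp
  | succ k ih =>
    obtain ⟨U, v, h1, h2, h3⟩ := h
    exact ⟨U, v, h1, ih h2, h3⟩

theorem mono {k l : ℕ} (hkl : k ≤ l) {u : ℝ → E} (h : MemH l u) : MemH k u := by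
  induction hkl with
  | refl => exact h
  | step _ ih => exact ih h.of_succ

theorem add {k : ℕ} {u w : ℝ → E} (h : MemH k u) (h' : MemH k w) :
    MemH k (fun x => u x + w x) := by
  induction k generalizing u w with
  | zero => exact MemLp.add h h'
  | succ k ih =>
    obtain ⟨U, v, h1, h2, h3⟩ := h
    obtain ⟨W, z, g1, g2, g3⟩ := h'
    exact ⟨_, _, h1.add g1, ih h2 g2, h3.add g3⟩

theorem clm [CompleteSpace E] [CompleteSpace F] {k : ℕ} {u : ℝ → E} (h : MemH k u)
    (A : E →L[ℝ] F) : MemH k (fun x => A (u x)) := by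
  induction k generalizing u with
  | zero => exact A.comp_memLp' h
  | succ k ih =>
    obtain ⟨U, v, h1, h2, h3⟩ := h
    exact ⟨_, _, h1.clm A, ih h2, h3.fun_comp A⟩

theorem exists_continuousOn {k : ℕ} {u : ℝ → E} (h : MemH (k + 1) u) :
    ∃ U, ContinuousOn U (Icc (0 : ℝ) 1) ∧ MemH (k + 1) U ∧
      u =ᵐ[volume.restrict (Icc (0 : ℝ) 1)] U := by
  obtain ⟨U, v, h1, h2, h3⟩ := h
  exact ⟨U, h1.continuousOn, ⟨U, v, h1, h2, .rfl⟩, h3⟩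

theorem exists_isPrimitive {k : ℕ} {u : ℝ → E} (h : MemH (k + 1) u)
    (hu : ContinuousOn u (Icc (0 : ℝ) 1)) : ∃ v, IsPrimitive u v ∧ MemH k v := by
  obtain ⟨U, v, h1, h2, h3⟩ := h
  exact ⟨v, h1.congr_left (IsPrimitive.eqOn_of_ae_eq hu h1.continuousOn h3), h2⟩

theorem exists_isPrimitive_continuousOn {k : ℕ} {u : ℝ → E} (h : MemH (k + 2) u)
    (hu : ContinuousOn u (Icc (0 : ℝ) 1)) :
    ∃ v, IsPrimitive u v ∧ MemH (k + 1) v ∧ ContinuousOn v (Icc (0 : ℝ) 1) := by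
  obtain ⟨v, h1, h2⟩ := h.exists_isPrimitive hu
  obtain ⟨V, h3, h4, h5⟩ := h2.exists_continuousOn
  exact ⟨V, h1.congr_deriv h5, h4, h3⟩

theorem of_isPrimitive {k : ℕ} {u v : ℝ → E} (h : IsPrimitive u v) (hv : MemH k v) :
    MemH (k + 1) u := ⟨u, v, h, hv, .rfl⟩

theorem memLp_top {k : ℕ} {u : ℝ → E} (h : MemH (k + 1) u) :
    MemLp u ⊤ (volume.restrict (Icc (0 : ℝ) 1)) := by
  obtain ⟨U, hU, -, h3⟩ := h.exists_continuousOn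
  obtain ⟨C, hC⟩ := isCompact_Icc.exists_bound_of_continuousOn hU
  exact (memLp_top_of_bound (hU.aestronglyMeasurable measurableSet_Icc) C
    (by filter_upwards [ae_restrict_mem measurableSet_Icc] with x hx using hC x hx)).ae_eq h3.symm

theorem bilin_succ [CompleteSpace E] [CompleteSpace F] [CompleteSpace G]
    (B : E →L[ℝ] F →L[ℝ] G) {k : ℕ} {u : ℝ → E} {w : ℝ → F} :
    (MemH k u → MemH (k + 1) w → MemH k (fun x => B (u x) (w x))) ∧
      (MemH (k + 1) u → MemH k w → MemH k (fun x => B (u x) (w x))) := by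
  induction k generalizing u w with
  | zero => exact ⟨fun h h' => B.memLp_of_bilin 2 h h'.memLp_top,
      fun h h' => B.memLp_of_bilin 2 h.memLp_top h'⟩
  | succ k ih =>
    suffices H : MemH (k + 1) u → MemH (k + 1) w → MemH (k + 1) (fun x => B (u x) (w x)) from
      ⟨fun h h' => H h h'.of_succ, fun h h' => H h.of_succ h'⟩
    intro h h'
    obtain ⟨U, v, h1, h2, h3⟩ := id h
    obtain ⟨W, z, g1, g2, g3⟩ := id h'
    refine ⟨_, _, h1.bilin B g1, (ih.1 h2 (h'.congr g3)).add (ih.2 (h.congr h3) g2), ?_⟩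
    filter_upwards [h3, g3] with x hx gx
    rw [hx, gx]

theorem bilin [CompleteSpace E] [CompleteSpace F] [CompleteSpace G]
    (B : E →L[ℝ] F →L[ℝ] G) {k : ℕ} {u : ℝ → E} {w : ℝ → F} (h : MemH (k + 1) u)
    (h' : MemH (k + 1) w) : MemH (k + 1) (fun x => B (u x) (w x)) := by
  obtain ⟨U, v, h1, h2, h3⟩ := id h
  obtain ⟨W, z, g1, g2, g3⟩ := id h'
  refine ⟨_, _, h1.bilin B g1,
    ((bilin_succ B).1 h2 (h'.congr g3)).add ((bilin_succ B).2 (h.congr h3) g2), ?_⟩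
  filter_upwards [h3, g3] with x hx gx
  rw [hx, gx]

end MemH

end MemH

/-! ### Integration by parts against test fields. -/

section WeakDerivative

variable {d : ℕ}

theorem IsTestField.continuous {η : ℝ → EuclideanSpace ℝ (Fin d)} (h : IsTestField η) :
    Continuous η := h.1.continuous

theorem IsTestField.eq_zero {η : ℝ → EuclideanSpace ℝ (Fin d)} (h : IsTestField η) {x : ℝ}
    (hx : x ∉ Ioo (0 : ℝ) 1) : η x = 0 :=
  image_eq_zero_of_notMem_tsupport fun hx' => hx (h.2.2 hx')

theorem IsTestField.deriv {η : ℝ → EuclideanSpace ℝ (Fin d)} (h : IsTestField η) :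
    IsTestField (deriv η) :=
  ⟨(contDiff_infty_iff_deriv.1 h.1).2, h.2.1.deriv, (tsupport_deriv_subset).trans h.2.2⟩

theorem IsTestField.isPrimitive {η : ℝ → EuclideanSpace ℝ (Fin d)} (h : IsTestField η) :
    IsPrimitive η (_root_.deriv η) :=
  .of_hasDerivAt (fun x _ => (h.1.differentiable (by simp) x).hasDerivAt.hasDerivWithinAt)
    h.deriv.continuous.continuousOn

theorem IsPrimitive.real_inner {u v w z : ℝ → EuclideanSpace ℝ (Fin d)}
    (h : IsPrimitive u v) (h' : IsPrimitive w z) :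
    IsPrimitive (fun x => (inner ℝ (u x) (w x) : ℝ))
      (fun x => inner ℝ (v x) (w x) + inner ℝ (u x) (z x)) :=
  h.bilin (innerSL ℝ) h'

theorem IsPrimitive.integral_inner_by_parts {u v w z : ℝ → EuclideanSpace ℝ (Fin d)}
    (h : IsPrimitive u v) (h' : IsPrimitive w z) :
    ∫ x in Icc (0 : ℝ) 1, (inner ℝ (v x) (w x) + inner ℝ (u x) (z x) : ℝ) =
      inner ℝ (u 1) (w 1) - inner ℝ (u 0) (w 0) := by
  exact (h.real_inner h').setIntegral_eq

theorem IsPrimitive.integrableOn_inner_left {u v z : ℝ → EuclideanSpace ℝ (Fin d)}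
    (h : IsPrimitive u v) (hz : IntegrableOn z (Icc (0 : ℝ) 1)) :
    IntegrableOn (fun x => (inner ℝ (u x) (z x) : ℝ)) (Icc (0 : ℝ) 1) := by
  obtain ⟨C, hC⟩ := isCompact_Icc.exists_bound_of_continuousOn h.continuousOn
  exact (innerSL ℝ).integrable_of_bilin_of_bdd_left C
      (h.continuousOn.aestronglyMeasurable measurableSet_Icc)
      (by filter_upwards [ae_restrict_mem measurableSet_Icc] with x hx using hC x hx) hz

end WeakDerivative

end ElasticCurve

namespace ElasticCurve

/-! ### Du Bois-Reymond lemmas: weak derivatives are derivatives of antiderivatives. -/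

section DuBoisReymond

variable {d : ℕ}

theorem integrableOn_inner_continuousOn {h η : ℝ → EuclideanSpace ℝ (Fin d)}
    (hh : IntegrableOn h (Icc (0 : ℝ) 1)) (hη : ContinuousOn η (Icc (0 : ℝ) 1)) :
    IntegrableOn (fun x => (inner ℝ (h x) (η x) : ℝ)) (Icc (0 : ℝ) 1) := by
  obtain ⟨C, hC⟩ := isCompact_Icc.exists_bound_of_continuousOn hη
  exact (innerSL ℝ).integrable_of_bilin_of_bdd_right C hh
      (hη.aestronglyMeasurable measurableSet_Icc)
      (by filter_upwards [ae_restrict_mem measurableSet_Icc] with x hx using hC x hx)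

theorem isTestField_smul_const {g : ℝ → ℝ} (hg : ContDiff ℝ ∞ g) (hc : HasCompactSupport g)
    (hs : tsupport g ⊆ Ioo (0 : ℝ) 1) (e : EuclideanSpace ℝ (Fin d)) :
    IsTestField fun x => g x • e :=
  ⟨hg.smul contDiff_const, hc.smul_right, (tsupport_smul_subset_left g _).trans hs⟩

theorem ae_eq_zero_of_integral_inner_testField {h : ℝ → EuclideanSpace ℝ (Fin d)}
    (hh : IntegrableOn h (Icc (0 : ℝ) 1))
    (H : ∀ η : ℝ → EuclideanSpace ℝ (Fin d), IsTestField η →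
      ∫ x in Icc (0 : ℝ) 1, (inner ℝ (h x) (η x) : ℝ) = 0) :
    h =ᵐ[volume.restrict (Icc (0 : ℝ) 1)] 0 := by
  have key := isOpen_Ioo.ae_eq_zero_of_integral_contDiff_smul_eq_zero (U := Ioo (0 : ℝ) 1)
    (μ := volume) (f := h) (hh.mono_set Ioo_subset_Icc_self).locallyIntegrableOn ?_
  · rw [← restrict_Ioo_eq_restrict_Icc]
    exact (ae_restrict_iff' measurableSet_Ioo).2 key
  · intro g hg hc hs
    have hz : ∀ x, x ∉ Icc (0 : ℝ) 1 → g x • h x = 0 := fun x hx => by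
      rw [image_eq_zero_of_notMem_tsupport fun hx' => hx (Ioo_subset_Icc_self (hs hx')), zero_smul]
    rw [← setIntegral_eq_integral_of_forall_compl_eq_zero hz]
    obtain ⟨C, hC⟩ := isCompact_Icc.exists_bound_of_continuousOn (s := Icc (0 : ℝ) 1)
      hg.continuous.continuousOn
    have hi : IntegrableOn (fun x => g x • h x) (Icc (0 : ℝ) 1) :=
      hh.bdd_smul C hg.continuous.aestronglyMeasurable
        (by filter_upwards [ae_restrict_mem measurableSet_Icc] with x hx using hC x hx)
    refine ext_inner_left ℝ fun e => ?_
    rw [← integral_inner hi, inner_zero_right]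
    refine Eq.trans ?_ (H _ (isTestField_smul_const hg hc hs e))
    refine integral_congr_ae (.of_forall fun x => ?_)
    simp only [inner_smul_right, real_inner_comm]

theorem exists_bump_integral_one : ∃ ρ : ℝ → ℝ, ContDiff ℝ ∞ ρ ∧ HasCompactSupport ρ ∧
    tsupport ρ ⊆ Ioo (0 : ℝ) 1 ∧ ∫ x in Icc (0 : ℝ) 1, ρ x = 1 := by
  let b : ContDiffBump (1 / 2 : ℝ) := ⟨1 / 8, 1 / 4, by norm_num, by norm_num⟩
  have hs : tsupport (b.normed volume) ⊆ Ioo (0 : ℝ) 1 := by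
    rw [b.tsupport_normed_eq, Real.closedBall_eq_Icc]
    intro x hx
    simp only [b, mem_Icc] at hx
    exact ⟨by linarith [hx.1], by linarith [hx.2]⟩
  refine ⟨b.normed volume, b.contDiff_normed, b.hasCompactSupport_normed, hs, ?_⟩
  rw [setIntegral_eq_integral_of_forall_compl_eq_zero, b.integral_normed]
  exact fun x hx => image_eq_zero_of_notMem_tsupport fun hx' => hx (Ioo_subset_Icc_self (hs hx'))

/-- The antiderivative from `0` vanishes to the left of the support of `ζ`; the zero mean makes it
vanish to the right as well. -/
theorem IsTestField.exists_antideriv {ζ : ℝ → EuclideanSpace ℝ (Fin d)} (h : IsTestField ζ)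
    (h0 : ∫ x in Icc (0 : ℝ) 1, ζ x = 0) : ∃ θ, IsTestField θ ∧ _root_.deriv θ = ζ := by
  have hi : ∀ a b, IntervalIntegrable ζ volume a b := fun a b => h.continuous.intervalIntegrable a b
  have hd : ∀ x, HasDerivAt (fun x => ∫ t in (0 : ℝ)..x, ζ t) (ζ x) x := fun x =>
    intervalIntegral.integral_hasDerivAt_right (hi _ _)
      (h.continuous.stronglyMeasurableAtFilter _ _) h.continuous.continuousAt
  have hderiv : _root_.deriv (fun x => ∫ t in (0 : ℝ)..x, ζ t) = ζ := funext fun x => (hd x).deriv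
  -- The extra point `1/2` keeps the compact set nonempty when `ζ = 0`, so that it has a least and a
  -- greatest element.
  have hK : IsCompact (insert (1 / 2 : ℝ) (tsupport ζ)) := h.2.1.isCompact.insert _
  have hK1 : insert (1 / 2 : ℝ) (tsupport ζ) ⊆ Ioo 0 1 :=
    insert_subset (by constructor <;> norm_num) h.2.2
  obtain ⟨a, ha⟩ := hK.exists_isLeast (insert_nonempty _ _)
  obtain ⟨b, hb⟩ := hK.exists_isGreatest (insert_nonempty _ _)
  have ha' := hK1 ha.1
  have hb' := hK1 hb.1
  have hζ : ∀ x, x ∉ Icc a b → ζ x = 0 := fun x hx =>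
    image_eq_zero_of_notMem_tsupport fun hx' =>
      hx ⟨ha.2 (mem_insert_of_mem _ hx'), hb.2 (mem_insert_of_mem _ hx')⟩
  have hθ : ∀ x, x ∉ Icc a b → ∫ t in (0 : ℝ)..x, ζ t = 0 := by
    intro x hx
    rcases lt_or_ge x a with hxa | hxa
    · refine (intervalIntegral.integral_congr (g := fun _ => 0)
        fun t ht => hζ t fun ht' => ?_).trans (by simp)
      rcases mem_uIcc.1 ht with h1 | h1 <;> linarith [ht'.1, ha'.1]
    · have hxb : b < x := by
        by_contra hxb
        exact hx ⟨hxa, not_lt.1 hxb⟩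
      have e1 : ∫ t in x..1, ζ t = 0 := by
        refine (intervalIntegral.integral_congr (g := fun _ => 0)
          fun t ht => hζ t fun ht' => ?_).trans (by simp)
        rcases mem_uIcc.1 ht with h1 | h1 <;> linarith [ht'.2, hb'.2]
      have e2 := intervalIntegral.integral_add_adjacent_intervals (hi 0 x) (hi x 1)
      rw [e1, add_zero] at e2
      rw [e2, intervalIntegral.integral_of_le zero_le_one, ← integral_Icc_eq_integral_Ioc, h0]
  have hsupp : tsupport (fun x => ∫ t in (0 : ℝ)..x, ζ t) ⊆ Icc a b :=
    closure_minimal (fun x hx => by_contra fun hx' => hx (hθ x hx')) isClosed_Icc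
  refine ⟨_, ⟨?_, ?_, hsupp.trans fun x hx => ⟨ha'.1.trans_le hx.1, hx.2.trans_lt hb'.2⟩⟩, hderiv⟩
  · rw [contDiff_infty_iff_deriv, hderiv]
    exact ⟨fun x => (hd x).differentiableAt, h.1⟩
  · exact isCompact_Icc.of_isClosed_subset (isClosed_tsupport _) hsupp

theorem IsTestField.sub {η ζ : ℝ → EuclideanSpace ℝ (Fin d)} (h : IsTestField η)
    (h' : IsTestField ζ) : IsTestField (fun x => η x - ζ x) := by
  have := h.add (h'.smul (-1))
  simpa [Pi.add_def, Pi.smul_def, sub_eq_add_neg] using this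

/-- Subtracting `ρ • m`, with `m` the mean of `ζ`, makes any test field `ζ` the derivative of a test
field. Hence `h` acts on `ζ` as the constant `c = ∫ ρ h` does. -/
theorem ae_eq_const_of_integral_inner_deriv_testField {h : ℝ → EuclideanSpace ℝ (Fin d)}
    (hh : IntegrableOn h (Icc (0 : ℝ) 1))
    (H : ∀ η : ℝ → EuclideanSpace ℝ (Fin d), IsTestField η →
      ∫ x in Icc (0 : ℝ) 1, (inner ℝ (h x) (deriv η x) : ℝ) = 0) :
    ∃ c, h =ᵐ[volume.restrict (Icc (0 : ℝ) 1)] fun _ => c := by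
  obtain ⟨ρ, r1, r2, r3, r4⟩ := exists_bump_integral_one
  obtain ⟨C, hC⟩ := isCompact_Icc.exists_bound_of_continuousOn (s := Icc (0 : ℝ) 1)
    r1.continuous.continuousOn
  have hi : IntegrableOn (fun x => ρ x • h x) (Icc (0 : ℝ) 1) :=
    hh.bdd_smul C r1.continuous.aestronglyMeasurable
      (by filter_upwards [ae_restrict_mem measurableSet_Icc] with x hx using hC x hx)
  set c := ∫ x in Icc (0 : ℝ) 1, ρ x • h x with hc
  refine ⟨c, ?_⟩
  have hci : IntegrableOn (fun _ : ℝ => c) (Icc (0 : ℝ) 1) :=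
    continuousOn_const.integrableOn_Icc
  suffices hz : (fun x => h x - c) =ᵐ[volume.restrict (Icc (0 : ℝ) 1)] 0 by
    filter_upwards [hz] with x hx using sub_eq_zero.1 hx
  refine ae_eq_zero_of_integral_inner_testField (hh.sub hci) fun ζ hζ => ?_
  set m := ∫ x in Icc (0 : ℝ) 1, ζ x with hm
  have t1 := isTestField_smul_const r1 r2 r3 m
  have hζi : IntegrableOn ζ (Icc (0 : ℝ) 1) := hζ.continuous.continuousOn.integrableOn_Icc
  have hmean : ∫ x in Icc (0 : ℝ) 1, (ζ x - ρ x • m) = 0 := by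
    rw [integral_sub hζi t1.continuous.continuousOn.integrableOn_Icc, integral_smul_const, r4,
      one_smul, ← hm, sub_self]
  obtain ⟨θ, hθ, hθ'⟩ := (hζ.sub t1).exists_antideriv hmean
  have e1 := H θ hθ
  rw [hθ'] at e1
  simp only [inner_sub_right] at e1
  rw [integral_sub (integrableOn_inner_continuousOn hh hζ.continuous.continuousOn)
    (integrableOn_inner_continuousOn hh t1.continuous.continuousOn)] at e1
  have e2 : ∫ x in Icc (0 : ℝ) 1, (inner ℝ (h x) (ρ x • m) : ℝ) = inner ℝ c m := by
    rw [real_inner_comm, hc, ← integral_inner hi]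
    refine integral_congr_ae (.of_forall fun x => ?_)
    simp only [inner_smul_right, real_inner_comm]
  have e3 : ∫ x in Icc (0 : ℝ) 1, (inner ℝ c (ζ x) : ℝ) = inner ℝ c m := integral_inner hζi c
  simp only [inner_sub_left]
  rw [integral_sub (integrableOn_inner_continuousOn hh hζ.continuous.continuousOn)
    (integrableOn_inner_continuousOn hci hζ.continuous.continuousOn), e3]
  linarith

theorem IsPrimitive.hasWeakDerivDx {u v : ℝ → EuclideanSpace ℝ (Fin d)} (h : IsPrimitive u v) :
    HasWeakDerivDx u v := fun η hη => by
  have := h.integral_inner_by_parts hη.isPrimitive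
  rw [integral_add (integrableOn_inner_continuousOn h.integrableOn hη.continuous.continuousOn)
    (h.integrableOn_inner_left hη.deriv.continuous.continuousOn.integrableOn_Icc),
    hη.eq_zero (x := 1) (by simp), hη.eq_zero (x := 0) (by simp)] at this
  simp only [inner_zero_right, sub_zero] at this
  linarith

theorem HasWeakDerivDx.congr {u v u' v' : ℝ → EuclideanSpace ℝ (Fin d)} (h : HasWeakDerivDx u v)
    (hu : u =ᵐ[volume.restrict (Icc (0 : ℝ) 1)] u')
    (hv : v =ᵐ[volume.restrict (Icc (0 : ℝ) 1)] v') :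
    HasWeakDerivDx u' v' := fun η hη => by
  have e1 : ∫ x in Icc (0 : ℝ) 1, (inner ℝ (u' x) (deriv η x) : ℝ) =
      ∫ x in Icc (0 : ℝ) 1, (inner ℝ (u x) (deriv η x) : ℝ) :=
    integral_congr_ae (by filter_upwards [hu] with x hx; rw [hx])
  have e2 : ∫ x in Icc (0 : ℝ) 1, (inner ℝ (v' x) (η x) : ℝ) =
      ∫ x in Icc (0 : ℝ) 1, (inner ℝ (v x) (η x) : ℝ) :=
    integral_congr_ae (by filter_upwards [hv] with x hx; rw [hx])
  rw [e1, e2, h η hη]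

/-- The difference of `u` and an antiderivative of `v` has weak derivative zero, so it is constant.
-/
theorem HasWeakDerivDx.exists_isPrimitive {u v : ℝ → EuclideanSpace ℝ (Fin d)}
    (h : HasWeakDerivDx u v) (hu : IntegrableOn u (Icc (0 : ℝ) 1))
    (hv : IntegrableOn v (Icc (0 : ℝ) 1)) :
    ∃ U, IsPrimitive U v ∧ u =ᵐ[volume.restrict (Icc (0 : ℝ) 1)] U := by
  have hV := isPrimitive_const_add_integral hv 0
  set V := fun x => (0 : EuclideanSpace ℝ (Fin d)) + ∫ t in (0 : ℝ)..x, v t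
  obtain ⟨c, hc⟩ := ae_eq_const_of_integral_inner_deriv_testField (h := fun x => u x - V x)
    (hu.sub hV.continuousOn.integrableOn_Icc) fun η hη => by
      simp only [inner_sub_left]
      rw [integral_sub (integrableOn_inner_continuousOn hu hη.deriv.continuous.continuousOn)
        (hV.integrableOn_inner_left hη.deriv.continuous.continuousOn.integrableOn_Icc), h η hη,
        hV.hasWeakDerivDx η hη, sub_self]
  refine ⟨_, isPrimitive_const_add_integral hv c, ?_⟩
  filter_upwards [hc] with x hx
  rw [← hx]
  simp [V]

theorem HasWeakDerivDx.unique {u v v' : ℝ → EuclideanSpace ℝ (Fin d)}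
    (h : HasWeakDerivDx u v) (h' : HasWeakDerivDx u v') (hv : IntegrableOn v (Icc (0 : ℝ) 1))
    (hv' : IntegrableOn v' (Icc (0 : ℝ) 1)) : v =ᵐ[volume.restrict (Icc (0 : ℝ) 1)] v' := by
  have : (fun x => v x - v' x) =ᵐ[volume.restrict (Icc (0 : ℝ) 1)] 0 := by
    refine ae_eq_zero_of_integral_inner_testField (hv.sub hv') fun η hη => ?_
    simp only [inner_sub_left]
    rw [integral_sub (integrableOn_inner_continuousOn hv hη.continuous.continuousOn)
      (integrableOn_inner_continuousOn hv' hη.continuous.continuousOn)]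
    linarith [h η hη, h' η hη]
  filter_upwards [this] with x hx using sub_eq_zero.1 hx

theorem IsPrimitive.ae_eq_deriv {u v u' v' : ℝ → EuclideanSpace ℝ (Fin d)} (h : IsPrimitive u v)
    (h' : IsPrimitive u' v') (hu : u =ᵐ[volume.restrict (Icc (0 : ℝ) 1)] u') :
    v =ᵐ[volume.restrict (Icc (0 : ℝ) 1)] v' :=
  (h.hasWeakDerivDx.congr hu .rfl).unique h'.hasWeakDerivDx h.integrableOn h'.integrableOn

/-- A function that is orthogonal to all second derivatives of test fields is affine. -/
theorem exists_isPrimitive_const_of_integral_inner_deriv_deriv_testField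
    {h : ℝ → EuclideanSpace ℝ (Fin d)} (hh : IntegrableOn h (Icc (0 : ℝ) 1))
    (H : ∀ η : ℝ → EuclideanSpace ℝ (Fin d), IsTestField η →
      ∫ x in Icc (0 : ℝ) 1, (inner ℝ (h x) (deriv (deriv η) x) : ℝ) = 0) :
    ∃ (b : EuclideanSpace ℝ (Fin d)) (U : ℝ → EuclideanSpace ℝ (Fin d)),
      IsPrimitive U (fun _ => b) ∧ h =ᵐ[volume.restrict (Icc (0 : ℝ) 1)] U := by
  obtain ⟨ρ, r1, r2, r3, r4⟩ := exists_bump_integral_one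
  have r1' : ContDiff ℝ ∞ (deriv ρ) := (contDiff_infty_iff_deriv.1 r1).2
  obtain ⟨C, hC⟩ := isCompact_Icc.exists_bound_of_continuousOn (s := Icc (0 : ℝ) 1)
    r1'.continuous.continuousOn
  have hi : IntegrableOn (fun x => deriv ρ x • h x) (Icc (0 : ℝ) 1) :=
    hh.bdd_smul C r1'.continuous.aestronglyMeasurable
      (by filter_upwards [ae_restrict_mem measurableSet_Icc] with x hx using hC x hx)
  set c := ∫ x in Icc (0 : ℝ) 1, deriv ρ x • h x with hc
  have hci : IntegrableOn (fun _ : ℝ => -c) (Icc (0 : ℝ) 1) :=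
    continuousOn_const.integrableOn_Icc
  -- It suffices that `h` has constant weak derivative `-c`. If `θ' = ζ - ρ m`, then `θ'' = ζ' - ρ'
  -- m`, and orthogonality of `h` to `θ''` reads `∫ ⟨h, ζ'⟩ = ⟨c, m⟩`.
  refine ⟨-c, HasWeakDerivDx.exists_isPrimitive (fun ζ hζ => ?_) hh hci⟩
  set m := ∫ x in Icc (0 : ℝ) 1, ζ x with hm
  have t1 := isTestField_smul_const r1 r2 r3 m
  have hζi : IntegrableOn ζ (Icc (0 : ℝ) 1) := hζ.continuous.continuousOn.integrableOn_Icc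
  have hmean : ∫ x in Icc (0 : ℝ) 1, (ζ x - ρ x • m) = 0 := by
    rw [integral_sub hζi t1.continuous.continuousOn.integrableOn_Icc, integral_smul_const, r4,
      one_smul, ← hm, sub_self]
  obtain ⟨θ, hθ, hθ'⟩ := (hζ.sub t1).exists_antideriv hmean
  have e1 := H θ hθ
  have hder : deriv (deriv θ) = fun x => deriv ζ x - deriv ρ x • m := by
    rw [hθ']
    funext x
    exact ((hζ.1.differentiable (by simp) x).hasDerivAt.sub
      ((r1.differentiable (by simp) x).hasDerivAt.smul_const m)).deriv
  rw [hder] at e1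
  simp only [inner_sub_right] at e1
  have t2 : ContinuousOn (fun x => deriv ρ x • m) (Icc 0 1) :=
    (r1'.continuous.smul continuous_const).continuousOn
  rw [integral_sub (integrableOn_inner_continuousOn hh hζ.deriv.continuous.continuousOn)
    (integrableOn_inner_continuousOn hh t2)] at e1
  have e2 : ∫ x in Icc (0 : ℝ) 1, (inner ℝ (h x) (deriv ρ x • m) : ℝ) = inner ℝ c m := by
    rw [real_inner_comm, hc, ← integral_inner hi]
    refine integral_congr_ae (.of_forall fun x => ?_)
    simp only [inner_smul_right, real_inner_comm]
  have e3 : ∫ x in Icc (0 : ℝ) 1, (inner ℝ (-c) (ζ x) : ℝ) = inner ℝ (-c) m :=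
    integral_inner hζi (-c)
  rw [e3, inner_neg_left]
  linarith

end DuBoisReymond

end ElasticCurve

namespace ElasticCurve

/-! ### Products of factors of different regularity. -/

section MemHProducts

variable {E F G : Type*} [NormedAddCommGroup E] [NormedSpace ℝ E] [CompleteSpace E]
  [NormedAddCommGroup F] [NormedSpace ℝ F] [CompleteSpace F]
  [NormedAddCommGroup G] [NormedSpace ℝ G] [CompleteSpace G]

theorem MemH.bilin_of_le (B : E →L[ℝ] F →L[ℝ] G) {k l : ℕ} (hk : k ≤ l + 1) {u : ℝ → E}
    {w : ℝ → F} (h : MemH (l + 1) u) (h' : MemH k w) : MemH k (fun x => B (u x) (w x)) := by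
  cases k with
  | zero => exact (MemH.bilin_succ B).2 (h.mono (by omega)) h'
  | succ k => exact MemH.bilin B (h.mono hk) h'

theorem MemH.smul_of_le {k l : ℕ} (hk : k ≤ l + 1) {u : ℝ → ℝ} {w : ℝ → F}
    (h : MemH (l + 1) u) (h' : MemH k w) : MemH k (fun x => u x • w x) :=
  MemH.bilin_of_le (ContinuousLinearMap.lsmul ℝ ℝ) hk h h'

theorem MemH.mul {k : ℕ} {u w : ℝ → ℝ} (h : MemH (k + 1) u) (h' : MemH (k + 1) w) :
    MemH (k + 1) (fun x => u x * w x) :=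
  MemH.bilin (ContinuousLinearMap.mul ℝ ℝ) h h'

theorem MemH.inner {d : ℕ} {k : ℕ} {u w : ℝ → EuclideanSpace ℝ (Fin d)} (h : MemH (k + 1) u)
    (h' : MemH (k + 1) w) : MemH (k + 1) (fun x => (inner ℝ (u x) (w x) : ℝ)) :=
  MemH.bilin (innerSL ℝ) h h'

end MemHProducts

variable {d : ℕ} {f : ℝ → EuclideanSpace ℝ (Fin d)}

theorem MemSobolev.memH {k : ℕ} (h : MemSobolev k f) : MemH k f := by
  obtain ⟨g, rfl, h1, h2⟩ := h
  have key : ∀ n i, i + n ≤ k → MemH n (g i) := by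
    intro n
    induction n with
    | zero => exact fun i hi => h1 i hi
    | succ n ih =>
      intro i hi
      have hv := ih (i + 1) (by omega)
      obtain ⟨U, hU, hU'⟩ := (h2 i (by omega)).exists_isPrimitive
        ((h1 i (by omega)).integrable one_le_two) hv.integrableOn
      exact ⟨U, _, hU, hv, hU'⟩
  exact key k 0 (by omega)

/-! ### Regularity of speed and tangent; comparison of `ds` with `dx`. -/

namespace IsRegularCurve

theorem velocity_memH_continuousOn (hf : IsRegularCurve 5 f) :
    MemH 4 (velocity f) ∧ ContinuousOn (velocity f) (Icc (0 : ℝ) 1) := by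
  obtain ⟨V, h1, h2, h3⟩ := hf.memSobolev.memH.exists_isPrimitive_continuousOn hf.continuousOn
  have hV : EqOn (velocity f) V (Icc (0 : ℝ) 1) := fun x hx =>
    (h1.hasDerivWithinAt h3 hx).derivWithin (uniqueDiffOn_Icc zero_lt_one x hx)
  refine ⟨h2.congr ?_, h3.congr hV⟩
  filter_upwards [ae_restrict_mem measurableSet_Icc] with x hx using (hV hx).symm

theorem velocity_memH (hf : IsRegularCurve 5 f) : MemH 4 (velocity f) :=
  hf.velocity_memH_continuousOn.1

theorem velocity_continuousOn (hf : IsRegularCurve 5 f) :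
    ContinuousOn (velocity f) (Icc (0 : ℝ) 1) :=
  hf.velocity_memH_continuousOn.2

theorem speed_pos (hf : IsRegularCurve 5 f) {x : ℝ} (hx : x ∈ Icc (0 : ℝ) 1) :
    0 < ‖velocity f x‖ := norm_pos_iff.2 (hf.velocity_ne_zero x hx)

theorem speed_continuousOn (hf : IsRegularCurve 5 f) :
    ContinuousOn (fun x => ‖velocity f x‖) (Icc (0 : ℝ) 1) := hf.velocity_continuousOn.norm

theorem inv_speed_continuousOn (hf : IsRegularCurve 5 f) :
    ContinuousOn (fun x => ‖velocity f x‖⁻¹) (Icc (0 : ℝ) 1) :=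
  hf.speed_continuousOn.inv₀ fun _ hx => (hf.speed_pos hx).ne'

/-- Bootstrapping: `q = |f_x|⁻¹` satisfies `q' = -q³ ⟨f_x, f_xx⟩`, so regularity of `q` feeds back
into `q'` and gains one order per step, until `f_xx ∈ H³` stops it. -/
theorem inv_speed_memH (hf : IsRegularCurve 5 f) : MemH 4 (fun x => ‖velocity f x‖⁻¹) := by
  obtain ⟨W, h1, h2, h3⟩ := hf.velocity_memH.exists_isPrimitive_continuousOn
    hf.velocity_continuousOn
  set q := fun x => ‖velocity f x‖⁻¹ with hq
  have hqc : ContinuousOn q (Icc (0 : ℝ) 1) := hf.inv_speed_continuousOn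
  have hp : IsPrimitive q
      (fun x => (-1 : ℝ) • ((q x * q x * q x) * inner ℝ (velocity f x) (W x))) := by
    refine .of_hasDerivAt (fun x hx => ?_) ?_
    · have d1 := h1.hasDerivWithinAt h3 hx
      have d2 := d1.inner ℝ d1
      have hne : (inner ℝ (velocity f x) (velocity f x) : ℝ) ≠ 0 :=
        inner_self_ne_zero.2 (hf.velocity_ne_zero x hx)
      have d3 := (d2.sqrt hne).inv (by
        rw [← norm_eq_sqrt_real_inner]; exact (hf.speed_pos hx).ne')
      simp only [← norm_eq_sqrt_real_inner] at d3
      refine d3.congr_deriv ?_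
      have := (hf.speed_pos hx).ne'
      simp only [hq, real_inner_comm (velocity f x) (W x), smul_eq_mul]
      field_simp
      ring
    · exact (((hqc.mul hqc).mul hqc).mul (hf.velocity_continuousOn.inner h3)).const_smul (-1 : ℝ)
  have hd : ∀ k ≤ 3, MemH (k + 1) q := by
    intro k hk
    induction k with
    | zero =>
      refine .of_isPrimitive hp (memLp_two_of_continuousOn ?_)
      exact (((hqc.mul hqc).mul hqc).mul (hf.velocity_continuousOn.inner h3)).const_smul (-1 : ℝ)
    | succ k ih =>
      have hk' := ih (by omega)
      refine .of_isPrimitive hp ?_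
      exact (((hk'.mul hk').mul hk').mul
        ((hf.velocity_memH.mono (by omega)).inner (h2.mono (by omega)))).clm
          (ContinuousLinearMap.lsmul ℝ ℝ (-1 : ℝ))
  exact hd 3 le_rfl

/-- Follows from the algebra property through `|f_x| = |f_x|⁻¹ ⟨f_x, f_x⟩`. -/
theorem speed_memH (hf : IsRegularCurve 5 f) : MemH 4 (fun x => ‖velocity f x‖) := by
  refine (hf.inv_speed_memH.mul (hf.velocity_memH.inner hf.velocity_memH)).congr ?_
  filter_upwards [ae_restrict_mem measurableSet_Icc] with x hx
  have := (hf.speed_pos hx).ne'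
  rw [real_inner_self_eq_norm_sq]
  field_simp

theorem unitTangent_memH (hf : IsRegularCurve 5 f) : MemH 4 (unitTangent f) :=
  MemH.smul_of_le (l := 3) le_rfl hf.inv_speed_memH hf.velocity_memH

theorem unitTangent_continuousOn (hf : IsRegularCurve 5 f) :
    ContinuousOn (unitTangent f) (Icc (0 : ℝ) 1) :=
  hf.inv_speed_continuousOn.smul hf.velocity_continuousOn

theorem norm_unitTangent (hf : IsRegularCurve 5 f) {x : ℝ} (hx : x ∈ Icc (0 : ℝ) 1) :
    ‖unitTangent f x‖ = 1 := by
  rw [unitTangent, norm_smul, norm_inv, norm_norm, inv_mul_cancel₀ (hf.speed_pos hx).ne']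

theorem exists_speed_bounds (hf : IsRegularCurve 5 f) :
    ∃ m M : ℝ, 0 < m ∧ ∀ x ∈ Icc (0 : ℝ) 1, m ≤ ‖velocity f x‖ ∧ ‖velocity f x‖ ≤ M := by
  obtain ⟨a, ha, ha'⟩ := isCompact_Icc.exists_isMinOn (nonempty_Icc.2 zero_le_one)
    hf.speed_continuousOn
  obtain ⟨b, hb, hb'⟩ := isCompact_Icc.exists_isMaxOn (nonempty_Icc.2 zero_le_one)
    hf.speed_continuousOn
  exact ⟨_, _, hf.speed_pos ha, fun x hx => ⟨ha' hx, hb' hx⟩⟩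

theorem aemeasurable_density (hf : IsRegularCurve 5 f) :
    AEMeasurable (fun x => ENNReal.ofReal ‖velocity f x‖) (volume.restrict (Icc (0 : ℝ) 1)) :=
  (hf.speed_continuousOn.aemeasurable measurableSet_Icc).ennreal_ofReal

theorem ae_arcMeasure (hf : IsRegularCurve 5 f) :
    ae (arcMeasure f) = ae (volume.restrict (Icc (0 : ℝ) 1)) := by
  refine le_antisymm (withDensity_absolutelyContinuous _ _).ae_le
    (withDensity_absolutelyContinuous' hf.aemeasurable_density ?_).ae_le
  filter_upwards [ae_restrict_mem measurableSet_Icc] with x hx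
  simpa using hf.velocity_ne_zero x hx

theorem arcMeasure_le (hf : IsRegularCurve 5 f) :
    ∃ C : ENNReal, C ≠ ⊤ ∧ arcMeasure f ≤ C • volume.restrict (Icc (0 : ℝ) 1) := by
  obtain ⟨m, M, -, h⟩ := hf.exists_speed_bounds
  refine ⟨ENNReal.ofReal M, ENNReal.ofReal_ne_top, ?_⟩
  rw [← withDensity_const]
  refine withDensity_mono ?_
  filter_upwards [ae_restrict_mem measurableSet_Icc] with x hx
  exact ENNReal.ofReal_le_ofReal (h x hx).2

theorem le_arcMeasure (hf : IsRegularCurve 5 f) :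
    ∃ C : ENNReal, C ≠ ⊤ ∧ volume.restrict (Icc (0 : ℝ) 1) ≤ C • arcMeasure f := by
  obtain ⟨m, M, hm, h⟩ := hf.exists_speed_bounds
  refine ⟨(ENNReal.ofReal m)⁻¹, ENNReal.inv_ne_top.2 (by simpa using hm), ?_⟩
  have h1 : ENNReal.ofReal m • volume.restrict (Icc (0 : ℝ) 1) ≤ arcMeasure f := by
    rw [← withDensity_const]
    refine withDensity_mono ?_
    filter_upwards [ae_restrict_mem measurableSet_Icc] with x hx
    exact ENNReal.ofReal_le_ofReal (h x hx).1
  intro s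
  have h2 := h1 s
  simp only [Measure.smul_apply, smul_eq_mul] at h2 ⊢
  rw [mul_comm, ← div_eq_mul_inv, ENNReal.le_div_iff_mul_le (by simp [hm]) (by simp), mul_comm]
  exact h2

theorem memLp_arcMeasure (hf : IsRegularCurve 5 f) {E : Type*} [NormedAddCommGroup E]
    {p : ENNReal} {u : ℝ → E} :
    MemLp u p (arcMeasure f) ↔ MemLp u p (volume.restrict (Icc (0 : ℝ) 1)) := by
  obtain ⟨C, hC, h1⟩ := hf.arcMeasure_le
  obtain ⟨D, hD, h2⟩ := hf.le_arcMeasure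
  exact ⟨fun h => h.of_measure_le_smul hD h2, fun h => h.of_measure_le_smul hC h1⟩

theorem integrable_arcMeasure (hf : IsRegularCurve 5 f) {E : Type*} [NormedAddCommGroup E]
    {u : ℝ → E} : Integrable u (arcMeasure f) ↔ IntegrableOn u (Icc (0 : ℝ) 1) := by
  rw [← memLp_one_iff_integrable, hf.memLp_arcMeasure, memLp_one_iff_integrable, IntegrableOn]

theorem integral_arcMeasure (hf : IsRegularCurve 5 f) (h : ℝ → ℝ) :
    ∫ x, h x ∂(arcMeasure f) = ∫ x in Icc (0 : ℝ) 1, ‖velocity f x‖ * h x := by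
  rw [arcMeasure, integral_withDensity_eq_integral_toReal_smul₀ hf.aemeasurable_density
    (.of_forall fun _ => ENNReal.ofReal_lt_top)]
  simp

theorem memLp_coe (hf : IsRegularCurve 5 f) (u : L2 f) :
    MemLp u 2 (volume.restrict (Icc (0 : ℝ) 1)) := hf.memLp_arcMeasure.1 (Lp.memLp u)

theorem integrableOn_coe (hf : IsRegularCurve 5 f) (u : L2 f) :
    IntegrableOn u (Icc (0 : ℝ) 1) := (hf.memLp_coe u).integrable one_le_two

theorem integrableOn_speed_smul (hf : IsRegularCurve 5 f) {v : ℝ → EuclideanSpace ℝ (Fin d)}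
    (hv : MemLp v 2 (volume.restrict (Icc (0 : ℝ) 1))) :
    IntegrableOn (fun x => ‖velocity f x‖ • v x) (Icc (0 : ℝ) 1) :=
  (MemH.smul_of_le (l := 3) (k := 0) (by omega) hf.speed_memH hv).integrableOn

/-- The density `|f_x|` of `ds` cancels the factor in `∂_s η` on one side and is absorbed into `v`
on the other. -/
theorem hasWeakDs_iff (hf : IsRegularCurve 5 f) {u v : L2 f} :
    HasWeakDs f u v ↔ HasWeakDerivDx u (fun x => ‖velocity f x‖ • v x) := by
  have e1 : ∀ η : ℝ → EuclideanSpace ℝ (Fin d),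
      ∫ x, inner ℝ (u x) (‖velocity f x‖⁻¹ • deriv η x) ∂(arcMeasure f) =
      ∫ x in Icc (0 : ℝ) 1, inner ℝ (u x) (deriv η x) := fun η => by
    rw [hf.integral_arcMeasure]
    refine setIntegral_congr_fun measurableSet_Icc fun x hx => ?_
    rw [inner_smul_right, ← mul_assoc, mul_inv_cancel₀ (hf.speed_pos hx).ne', one_mul]
  have e2 : ∀ η : ℝ → EuclideanSpace ℝ (Fin d),
      ∫ x, inner ℝ (v x) (η x) ∂(arcMeasure f) =
      ∫ x in Icc (0 : ℝ) 1, inner ℝ (‖velocity f x‖ • v x) (η x) := fun η => by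
    rw [hf.integral_arcMeasure]
    refine setIntegral_congr_fun measurableSet_Icc fun x hx => ?_
    rw [real_inner_smul_left]
  constructor
  · intro h η hη
    obtain ⟨-, -, h3⟩ := h η hη
    rwa [e1, e2] at h3
  · intro h η hη
    refine ⟨?_, ?_, ?_⟩
    · rw [hf.integrable_arcMeasure]
      exact integrableOn_inner_continuousOn (hf.integrableOn_coe u)
        (hf.inv_speed_continuousOn.smul hη.deriv.continuous.continuousOn)
    · rw [hf.integrable_arcMeasure]
      exact integrableOn_inner_continuousOn (hf.integrableOn_coe v) hη.continuous.continuousOn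
    · rw [e1, e2]
      exact h η hη

theorem exists_isPrimitive_of_hasWeakDs (hf : IsRegularCurve 5 f) {u v : L2 f}
    (h : HasWeakDs f u v) : ∃ U, IsPrimitive U (fun x => ‖velocity f x‖ • v x) ∧
      u =ᵐ[volume.restrict (Icc (0 : ℝ) 1)] U :=
  (hf.hasWeakDs_iff.1 h).exists_isPrimitive (hf.integrableOn_coe u)
    (hf.integrableOn_speed_smul (hf.memLp_coe v))

theorem hasWeakDs_of_isPrimitive (hf : IsRegularCurve 5 f) {u v : L2 f}
    {U : ℝ → EuclideanSpace ℝ (Fin d)}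
    (h : IsPrimitive U (fun x => ‖velocity f x‖ • v x))
    (hu : u =ᵐ[volume.restrict (Icc (0 : ℝ) 1)] U) : HasWeakDs f u v :=
  hf.hasWeakDs_iff.2 (h.hasWeakDerivDx.congr hu.symm .rfl)

theorem ext_ae (hf : IsRegularCurve 5 f) {u v : L2 f}
    (h : u =ᵐ[volume.restrict (Icc (0 : ℝ) 1)] v) : u = v := by
  refine Lp.ext ?_
  rw [Filter.EventuallyEq, hf.ae_arcMeasure]
  exact h

theorem ae_iff (hf : IsRegularCurve 5 f) {p : ℝ → Prop} :
    (∀ᵐ x ∂(arcMeasure f), p x) ↔ ∀ᵐ x ∂(volume.restrict (Icc (0 : ℝ) 1)), p x := by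
  rw [hf.ae_arcMeasure]

theorem hasWeakDs_unique (hf : IsRegularCurve 5 f) {u v w : L2 f} (h : HasWeakDs f u v)
    (h' : HasWeakDs f u w) : v = w := by
  have := (hf.hasWeakDs_iff.1 h).unique (hf.hasWeakDs_iff.1 h')
    (hf.integrableOn_speed_smul (hf.memLp_coe v)) (hf.integrableOn_speed_smul (hf.memLp_coe w))
  refine hf.ext_ae ?_
  filter_upwards [this, ae_restrict_mem measurableSet_Icc] with x hx hx'
  exact smul_right_injective _ (hf.speed_pos hx').ne' hx

/-- The class in `L²(ds_f)` of a function that is square integrable on `[0,1]`. -/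
noncomputable def toL2 (hf : IsRegularCurve 5 f) {u : ℝ → EuclideanSpace ℝ (Fin d)}
    (hu : MemLp u 2 (volume.restrict (Icc (0 : ℝ) 1))) : L2 f :=
  (hf.memLp_arcMeasure.2 hu).toLp u

theorem coe_toL2 (hf : IsRegularCurve 5 f) {u : ℝ → EuclideanSpace ℝ (Fin d)}
    (hu : MemLp u 2 (volume.restrict (Icc (0 : ℝ) 1))) :
    hf.toL2 hu =ᵐ[volume.restrict (Icc (0 : ℝ) 1)] u :=
  hf.ae_iff.1 (MemLp.coeFn_toLp _)

end IsRegularCurve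

end ElasticCurve

/-! ### Completeness of `H^k(ds)` and boundedness of `∇_s`. -/

namespace ElasticCurve

theorem MemH.sub {E : Type*} [NormedAddCommGroup E] [NormedSpace ℝ E] [CompleteSpace E] {k : ℕ}
    {u w : ℝ → E} (h : MemH k u) (h' : MemH k w) : MemH k (fun x => u x - w x) := by
  simpa [sub_eq_add_neg] using h.add (h'.clm (-ContinuousLinearMap.id ℝ E))

/-- A continuous linear map into `Z` with values in the image of a Banach space `Y` that is
continuously embedded in `Z` is continuous as a map into `Y`. -/
theorem exists_continuousLinearMap_lift {X Y Z : Type*} [NormedAddCommGroup X] [NormedSpace ℝ X]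
    [CompleteSpace X] [NormedAddCommGroup Y] [NormedSpace ℝ Y] [CompleteSpace Y]
    [NormedAddCommGroup Z] [NormedSpace ℝ Z] (J : Y →L[ℝ] Z) (hJ : Function.Injective J)
    (A : X →L[ℝ] Z) (h : ∀ x, ∃ y, J y = A x) : ∃ B : X →L[ℝ] Y, ∀ x, J (B x) = A x := by
  choose b hb using h
  let B : X →ₗ[ℝ] Y :=
    { toFun := b
      map_add' := fun x y => hJ (by simp [hb])
      map_smul' := fun r x => hJ (by simp [hb]) }
  -- Closed graph theorem: if `u n → x` and `B (u n) → y`, then `A (u n) = J (B (u n))` tends to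
  -- both `A x` and `J y` in `Z`.
  refine ⟨⟨B, B.continuous_of_seq_closed_graph fun u x y hu hy => hJ ?_⟩, hb⟩
  have h1 : Filter.Tendsto (fun n => A (u n)) Filter.atTop (nhds (A x)) :=
    (A.continuous.tendsto x).comp hu
  have h2 : Filter.Tendsto (fun n => A (u n)) Filter.atTop (nhds (J y)) := by
    simpa [Function.comp_def, B, hb] using (J.continuous.tendsto y).comp hy
  exact (tendsto_nhds_unique h2 h1).trans (hb x).symm

variable {d : ℕ} {f : ℝ → EuclideanSpace ℝ (Fin d)}

/-- The `i`-th derivative, as a continuous linear map `H^k → L²`. -/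
noncomputable def Sobolev.component (f : ℝ → EuclideanSpace ℝ (Fin d)) (k : ℕ) (i : Fin (k + 1)) :
    Sobolev f k →L[ℝ] L2 f :=
  (PiLp.proj 1 (fun _ : Fin (k + 1) => L2 f) i).comp (Sobolev f k).subtypeL

/-- `(φ, ∂_s φ, …, ∂_s^{k+1} φ) ↦ (∂_s φ, …, ∂_s^{k+1} φ)`. -/
def Sobolev.tail {k : ℕ} (u : Sobolev f (k + 1)) : Sobolev f k :=
  ⟨WithLp.toLp 1 fun i : Fin (k + 1) => u.1 i.succ, fun i => u.2 i.succ⟩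

/-- `(v, ∂_s v, …, ∂_s^k v) ↦ (u, v, …, ∂_s^k v)`, where `v = ∂_s u`. -/
def Sobolev.cons {k : ℕ} (u : L2 f) (v : Sobolev f k) (h : HasWeakDs f u (v.1 0)) :
    Sobolev f (k + 1) :=
  ⟨WithLp.toLp 1 (Fin.cons u fun i : Fin (k + 1) => v.1 i), fun i => by
    induction i using Fin.cases with
    | zero => exact h
    | succ i => exact v.2 i⟩

namespace IsRegularCurve

/-- Writing the weak derivative relation as pairings with fixed elements of `L²` shows that it is
closed, which makes `H^k(ds)` complete. -/
theorem hasWeakDs_iff_inner (hf : IsRegularCurve 5 f) {u v : L2 f} :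
    HasWeakDs f u v ↔ ∀ (η : ℝ → EuclideanSpace ℝ (Fin d)) (hη : IsTestField η),
      (inner ℝ u (hf.toL2 (memLp_two_of_continuousOn
        (hf.inv_speed_continuousOn.smul hη.deriv.continuous.continuousOn))) : ℝ) +
      inner ℝ v (hf.toL2 (memLp_two_of_continuousOn hη.continuous.continuousOn)) = 0 := by
  refine forall₂_congr fun η hη => ?_
  set a := hf.toL2 (memLp_two_of_continuousOn
        (hf.inv_speed_continuousOn.smul hη.deriv.continuous.continuousOn)) with ha
  set b := hf.toL2 (memLp_two_of_continuousOn hη.continuous.continuousOn) with hb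
  have ea : (fun x => (inner ℝ (u x) (a x) : ℝ)) =ᵐ[arcMeasure f]
      fun x => inner ℝ (u x) (‖velocity f x‖⁻¹ • deriv η x) := by
    filter_upwards [hf.ae_iff.2 (hf.coe_toL2 (memLp_two_of_continuousOn
        (hf.inv_speed_continuousOn.smul hη.deriv.continuous.continuousOn)))] with x hx
    rw [ha, hx]; rfl
  have eb : (fun x => (inner ℝ (v x) (b x) : ℝ)) =ᵐ[arcMeasure f]
      fun x => inner ℝ (v x) (η x) := by
    filter_upwards [hf.ae_iff.2 (hf.coe_toL2
      (memLp_two_of_continuousOn hη.continuous.continuousOn))] with x hx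
    rw [hb, hx]
  rw [L2.inner_def, L2.inner_def, integral_congr_ae ea, integral_congr_ae eb,
    ← eq_neg_iff_add_eq_zero]
  exact ⟨fun h => h.2.2, fun h => ⟨(L2.integrable_inner u a).congr ea,
    (L2.integrable_inner v b).congr eb, h⟩⟩

theorem isClosed_hasWeakDs (hf : IsRegularCurve 5 f) :
    IsClosed {p : L2 f × L2 f | HasWeakDs f p.1 p.2} := by
  simp only [hf.hasWeakDs_iff_inner, ofPred_forall]
  exact isClosed_iInter fun η => isClosed_iInter fun hη =>
    isClosed_eq (by fun_prop) continuous_const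

theorem isClosed_sobolev (hf : IsRegularCurve 5 f) (k : ℕ) :
    IsClosed (Sobolev f k : Set (PiLp 1 fun _ : Fin (k + 1) => L2 f)) := by
  have : (Sobolev f k : Set (PiLp 1 fun _ : Fin (k + 1) => L2 f)) =
      ⋂ i : Fin k, (fun u : PiLp 1 fun _ : Fin (k + 1) => L2 f => (u i.castSucc, u i.succ)) ⁻¹'
        {p : L2 f × L2 f | HasWeakDs f p.1 p.2} := by
    ext u
    simp only [mem_iInter, mem_preimage]
    rfl
  rw [this]
  exact isClosed_iInter fun i => hf.isClosed_hasWeakDs.preimage (by fun_prop)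

theorem completeSpace_sobolev (hf : IsRegularCurve 5 f) (k : ℕ) : CompleteSpace (Sobolev f k) :=
  (hf.isClosed_sobolev k).completeSpace_coe

theorem sobolev_ext (hf : IsRegularCurve 5 f) {k : ℕ} {u v : Sobolev f k}
    (h : u.1 0 = v.1 0) : u = v := by
  have key : ∀ i : Fin (k + 1), u.1 i = v.1 i := by
    intro i
    induction i using Fin.induction with
    | zero => exact h
    | succ i ih => exact hf.hasWeakDs_unique (u.2 i) (ih ▸ v.2 i)
  exact Subtype.ext (PiLp.ext key)

/-- With `exists_sobolev` this identifies `H^k(ds)` with `H^k(dx)`. The bound `k ≤ 5` arises because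
only derivatives, of order at most `k - 1 ≤ 4`, get multiplied by the `H⁴` function `|f_x|` or its
inverse. -/
theorem memH_coe (hf : IsRegularCurve 5 f) {k : ℕ} (hk : k ≤ 5) (u : Sobolev f k) :
    MemH k (u.1 0) := by
  induction k with
  | zero => exact hf.memLp_coe _
  | succ k ih =>
    obtain ⟨U, h1, h2⟩ := hf.exists_isPrimitive_of_hasWeakDs (u.2 0)
    exact ⟨U, _, h1, MemH.smul_of_le (l := 3) (by omega) hf.speed_memH
      (ih (by omega) (Sobolev.tail u)), h2⟩

theorem exists_sobolev (hf : IsRegularCurve 5 f) {k : ℕ} (hk : k ≤ 5) (u : L2 f)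
    (h : MemH k u) : ∃ U : Sobolev f k, U.1 0 = u := by
  induction k generalizing u with
  | zero => exact ⟨⟨WithLp.toLp 1 fun _ => u, fun i => i.elim0⟩, rfl⟩
  | succ k ih =>
    obtain ⟨U, v, h1, h2, h3⟩ := h
    have h4 : MemH k (fun x => ‖velocity f x‖⁻¹ • v x) :=
      MemH.smul_of_le (l := 3) (by omega) hf.inv_speed_memH h2
    obtain ⟨Y, hY⟩ := ih (by omega) (hf.toL2 h4.memLp) (h4.congr (hf.coe_toL2 _).symm)
    refine ⟨Sobolev.cons u Y (hf.hasWeakDs_of_isPrimitive (h1.congr_deriv ?_) h3), rfl⟩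
    rw [hY]
    filter_upwards [hf.coe_toL2 h4.memLp, ae_restrict_mem measurableSet_Icc] with x hx hx'
    rw [hx, smul_smul, mul_inv_cancel₀ (hf.speed_pos hx').ne', one_smul]

theorem memH_normalPart (hf : IsRegularCurve 5 f) {k : ℕ} (hk : k ≤ 4)
    {v : ℝ → EuclideanSpace ℝ (Fin d)} (hv : MemH k v) :
    MemH k (fun x => v x - (inner ℝ (v x) (unitTangent f x) : ℝ) • unitTangent f x) := by
  have h1 : MemH k (fun x => (inner ℝ (unitTangent f x) (v x) : ℝ)) :=
    MemH.bilin_of_le (innerSL ℝ) (l := 3) hk hf.unitTangent_memH hv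
  have h2 := MemH.bilin_of_le (ContinuousLinearMap.lsmul ℝ ℝ).flip (l := 3) hk
    hf.unitTangent_memH h1
  refine (hv.sub h2).congr (.of_forall fun x => ?_)
  simp [real_inner_comm]

/-- The pointwise projection of `L²` fields onto the normal space of the curve. -/
noncomputable def normalProj (hf : IsRegularCurve 5 f) : L2 f →L[ℝ] L2 f :=
  LinearMap.mkContinuous
    { toFun := fun v => hf.toL2 (hf.memH_normalPart (k := 0) (by omega) (hf.memLp_coe v)).memLp
      map_add' := fun u v => hf.ext_ae <| by
        filter_upwards [hf.coe_toL2 (hf.memH_normalPart (k := 0) (by omega) (hf.memLp_coe u)).memLp,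
          hf.coe_toL2 (hf.memH_normalPart (k := 0) (by omega) (hf.memLp_coe v)).memLp,
          hf.coe_toL2 (hf.memH_normalPart (k := 0) (by omega) (hf.memLp_coe (u + v))).memLp,
          hf.ae_iff.1 (Lp.coeFn_add u v), hf.ae_iff.1 (Lp.coeFn_add
            (hf.toL2 (hf.memH_normalPart (k := 0) (by omega) (hf.memLp_coe u)).memLp)
            (hf.toL2 (hf.memH_normalPart (k := 0) (by omega) (hf.memLp_coe v)).memLp))]
          with x h1 h2 h3 h4 h5
        rw [h3, h5, Pi.add_apply, h1, h2, h4, Pi.add_apply, inner_add_left, add_smul]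
        abel
      map_smul' := fun r v => hf.ext_ae <| by
        filter_upwards [hf.coe_toL2 (hf.memH_normalPart (k := 0) (by omega) (hf.memLp_coe v)).memLp,
          hf.coe_toL2 (hf.memH_normalPart (k := 0) (by omega) (hf.memLp_coe (r • v))).memLp,
          hf.ae_iff.1 (Lp.coeFn_smul r v), hf.ae_iff.1 (Lp.coeFn_smul r
            (hf.toL2 (hf.memH_normalPart (k := 0) (by omega) (hf.memLp_coe v)).memLp))]
          with x h1 h2 h3 h4
        rw [RingHom.id_apply, h4, Pi.smul_apply, h1, h2, h3, Pi.smul_apply, real_inner_smul_left,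
          smul_sub, mul_smul] } 2 fun v => by
    refine Lp.norm_le_mul_norm_of_ae_le_mul (hf.ae_iff.2 ?_)
    filter_upwards [hf.coe_toL2 (hf.memH_normalPart (k := 0) (by omega) (hf.memLp_coe v)).memLp,
      ae_restrict_mem measurableSet_Icc] with x h1 hx
    change ‖hf.toL2 (hf.memH_normalPart (k := 0) (by omega) (hf.memLp_coe v)).memLp x‖ ≤ _
    rw [h1]
    refine (norm_sub_le _ _).trans ?_
    have h2 := norm_inner_le_norm (𝕜 := ℝ) (v x) (unitTangent f x)
    rw [hf.norm_unitTangent hx, mul_one] at h2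
    rw [norm_smul, hf.norm_unitTangent hx, mul_one]
    linarith

theorem coe_normalProj (hf : IsRegularCurve 5 f) (v : L2 f) :
    hf.normalProj v =ᵐ[volume.restrict (Icc (0 : ℝ) 1)]
      fun x => v x - (inner ℝ (v x) (unitTangent f x) : ℝ) • unitTangent f x :=
  hf.coe_toL2 (hf.memH_normalPart (k := 0) (by omega) (hf.memLp_coe v)).memLp

theorem hasNablaS_iff (hf : IsRegularCurve 5 f) {φ ψ v : L2 f} (h : HasWeakDs f φ v) :
    HasNablaS f φ ψ ↔ ψ = hf.normalProj v := by
  constructor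
  · rintro ⟨w, hw, hψ⟩
    obtain rfl := hf.hasWeakDs_unique h hw
    refine hf.ext_ae ?_
    filter_upwards [hf.ae_iff.1 hψ, hf.coe_normalProj v] with x h1 h2
    rw [h1, h2]
  · rintro rfl
    exact ⟨v, h, hf.ae_iff.2 (hf.coe_normalProj v)⟩

/-- The map `φ ↦ ∇_s φ` is visibly bounded into `L²`, and its values lie in `H^k` because the
tangent is `H⁴`. The closed graph theorem upgrades this to boundedness into `H^k` without norm
estimates. -/
theorem exists_nablaS (hf : IsRegularCurve 5 f) {k : ℕ} (hk : k ≤ 4) :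
    ∃ N : Sobolev f (k + 1) →L[ℝ] Sobolev f k, ∀ (φ : Sobolev f (k + 1)) (ψ : L2 f),
      HasNablaS f (φ.1 0) ψ ↔ ψ = (N φ).1 0 := by
  have := hf.completeSpace_sobolev k
  have := hf.completeSpace_sobolev (k + 1)
  obtain ⟨N, hN⟩ := exists_continuousLinearMap_lift (Sobolev.component f k 0)
    (fun u v h => hf.sobolev_ext h) (hf.normalProj.comp (Sobolev.component f (k + 1) 1)) fun φ => by
      refine hf.exists_sobolev (by omega) _ ?_
      exact (hf.memH_normalPart hk (hf.memH_coe (by omega) (Sobolev.tail φ))).congr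
        (hf.coe_normalProj _).symm
  refine ⟨N, fun φ ψ => ?_⟩
  have h1 : (N φ).1 0 = hf.normalProj (φ.1 (Fin.succ 0)) := hN φ
  rw [h1]
  exact hf.hasNablaS_iff (φ.2 0)

theorem mem_L2Normal_of_hasNablaS (hf : IsRegularCurve 5 f) {φ ψ : L2 f} (h : HasNablaS f φ ψ) :
    ψ ∈ L2Normal f := by
  obtain ⟨v, -, hψ⟩ := h
  change ∀ᵐ x ∂(arcMeasure f), (inner ℝ (ψ x) (velocity f x) : ℝ) = 0
  filter_upwards [hψ, hf.ae_iff.2 (ae_restrict_mem measurableSet_Icc)] with x hx hx'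
  have h1 : velocity f x = ‖velocity f x‖ • unitTangent f x := by
    rw [unitTangent, smul_smul, mul_inv_cancel₀ (hf.speed_pos hx').ne', one_smul]
  have h2 : (inner ℝ (unitTangent f x) (unitTangent f x) : ℝ) = 1 := by
    rw [real_inner_self_eq_norm_sq, hf.norm_unitTangent hx', one_pow]
  rw [hx, h1, inner_smul_right, inner_sub_left, real_inner_smul_left, h2]
  ring

theorem exists_iterNablaS (hf : IsRegularCurve 5 f) :
    ∃ T : Sobolev f 4 →L[ℝ] L2 f, ∀ (φ : Sobolev f 4) (ψ : L2 f),
      HasIterNablaS f 4 (φ.1 0) ψ ↔ ψ = T φ := by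
  obtain ⟨N0, h0⟩ := hf.exists_nablaS (k := 0) (by omega)
  obtain ⟨N1, h1⟩ := hf.exists_nablaS (k := 1) (by omega)
  obtain ⟨N2, h2⟩ := hf.exists_nablaS (k := 2) (by omega)
  obtain ⟨N3, h3⟩ := hf.exists_nablaS (k := 3) (by omega)
  refine ⟨(Sobolev.component f 0 0).comp (N0.comp (N1.comp (N2.comp N3))), fun φ ψ => ?_⟩
  simp [HasIterNablaS, h0, h1, h2, h3]
  rfl

end IsRegularCurve

end ElasticCurve

/-! ### `H²₀(ds)` characterized by clamped boundary values. -/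

namespace ElasticCurve

variable {d : ℕ} {f : ℝ → EuclideanSpace ℝ (Fin d)}

theorem IsTestField.memH {η : ℝ → EuclideanSpace ℝ (Fin d)} (h : IsTestField η) (k : ℕ) :
    MemH k η := by
  induction k generalizing η with
  | zero => exact memLp_two_of_continuousOn h.continuous.continuousOn
  | succ k ih => exact .of_isPrimitive h.isPrimitive (ih h.deriv)

/-- If a second order functional vanishes on all test fields, then it vanishes on all fields with
clamped boundary values. -/
theorem integral_eq_zero_of_clamped {a₀ a₁ a₂ : ℝ → EuclideanSpace ℝ (Fin d)}
    (h₀ : IntegrableOn a₀ (Icc (0 : ℝ) 1)) (h₁ : MemLp a₁ 2 (volume.restrict (Icc (0 : ℝ) 1)))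
    (h₂ : MemLp a₂ 2 (volume.restrict (Icc (0 : ℝ) 1)))
    (H : ∀ η : ℝ → EuclideanSpace ℝ (Fin d), IsTestField η → ∫ x in Icc (0 : ℝ) 1,
      (inner ℝ (a₀ x) (η x) + inner ℝ (a₁ x) (deriv η x) + inner ℝ (a₂ x) (deriv (deriv η) x) : ℝ)
        = 0)
    {u v w : ℝ → EuclideanSpace ℝ (Fin d)} (huv : IsPrimitive u v) (hvw : IsPrimitive v w)
    (hw : MemLp w 2 (volume.restrict (Icc (0 : ℝ) 1)))
    (hu0 : u 0 = 0) (hu1 : u 1 = 0) (hv0 : v 0 = 0) (hv1 : v 1 = 0) :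
    ∫ x in Icc (0 : ℝ) 1,
      (inner ℝ (a₀ x) (u x) + inner ℝ (a₁ x) (v x) + inner ℝ (a₂ x) (w x) : ℝ) = 0 := by
  -- With `P' = a₀` and `Q' = a₁ - P`, two integrations by parts turn the functional into `∫ ⟨a₂ -
  -- Q, w⟩`. Vanishing on test fields makes `a₂ - Q` affine, and affine functions are orthogonal to
  -- second derivatives of clamped fields.
  have hP := isPrimitive_const_add_integral h₀ 0
  set P := fun x => (0 : EuclideanSpace ℝ (Fin d)) + ∫ t in (0 : ℝ)..x, a₀ t
  have hQ := isPrimitive_const_add_integral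
    ((h₁.integrable one_le_two).sub hP.continuousOn.integrableOn_Icc) 0
  set Q := fun x => (0 : EuclideanSpace ℝ (Fin d)) + ∫ t in (0 : ℝ)..x, (a₁ - P) t
  have hR : MemLp (fun x => a₂ x - Q x) 2 (volume.restrict (Icc (0 : ℝ) 1)) :=
    h₂.sub (memLp_two_of_continuousOn hQ.continuousOn)
  have key : ∀ u v w : ℝ → EuclideanSpace ℝ (Fin d), IsPrimitive u v → IsPrimitive v w →
      MemLp w 2 (volume.restrict (Icc (0 : ℝ) 1)) → u 0 = 0 → u 1 = 0 → v 0 = 0 → v 1 = 0 →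
      ∫ x in Icc (0 : ℝ) 1,
        (inner ℝ (a₀ x) (u x) + inner ℝ (a₁ x) (v x) + inner ℝ (a₂ x) (w x) : ℝ) =
      ∫ x in Icc (0 : ℝ) 1, (inner ℝ (a₂ x - Q x) (w x) : ℝ) := by
    intro u v w huv hvw hw hu0 hu1 hv0 hv1
    have i1 := (hP.bilin (innerSL ℝ) huv).integrableOn
    have i2 := (hQ.bilin (innerSL ℝ) hvw).integrableOn
    have i3 : IntegrableOn (fun x => (inner ℝ (a₂ x - Q x) (w x) : ℝ)) (Icc (0 : ℝ) 1) :=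
      memLp_one_iff_integrable.1 ((innerSL ℝ).memLp_of_bilin 1 hR hw)
    have e1 := (hP.bilin (innerSL ℝ) huv).setIntegral_eq
    have e2 := (hQ.bilin (innerSL ℝ) hvw).setIntegral_eq
    simp only [hu0, hu1, hv0, hv1, map_zero, sub_zero] at e1 e2
    have e3 : ∀ x, (inner ℝ (a₀ x) (u x) + inner ℝ (a₁ x) (v x) + inner ℝ (a₂ x) (w x) : ℝ) =
        (innerSL ℝ (a₀ x) (u x) + innerSL ℝ (P x) (v x)) +
        (innerSL ℝ ((a₁ - P) x) (v x) + innerSL ℝ (Q x) (w x)) +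
        inner ℝ (a₂ x - Q x) (w x) := by
      intro x
      simp only [innerSL_apply_apply, Pi.sub_apply, inner_sub_left]
      ring
    simp only [e3]
    have i12 : IntegrableOn (fun x => (innerSL ℝ (a₀ x) (u x) + innerSL ℝ (P x) (v x)) +
        (innerSL ℝ ((a₁ - P) x) (v x) + innerSL ℝ (Q x) (w x))) (Icc (0 : ℝ) 1) := i1.add i2
    rw [integral_add i12 i3, integral_add i1 i2, e1, e2]
    simp
  obtain ⟨b, Y, hY, hY'⟩ := exists_isPrimitive_const_of_integral_inner_deriv_deriv_testField
    (hR.integrable one_le_two) fun η hη => by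
      rw [← key η _ _ hη.isPrimitive hη.deriv.isPrimitive (hη.deriv.deriv.memH 0)
        (hη.eq_zero (by simp)) (hη.eq_zero (by simp)) (hη.deriv.eq_zero (by simp))
        (hη.deriv.eq_zero (by simp)), H η hη]
  rw [key u v w huv hvw hw hu0 hu1 hv0 hv1]
  have e1 : ∫ x in Icc (0 : ℝ) 1, (inner ℝ (a₂ x - Q x) (w x) : ℝ) =
      ∫ x in Icc (0 : ℝ) 1, (inner ℝ (Y x) (w x) : ℝ) :=
    integral_congr_ae (by filter_upwards [hY'] with x hx; rw [hx])
  have e2 := hY.integral_inner_by_parts hvw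
  have e3 : ∫ x in Icc (0 : ℝ) 1, (inner ℝ b (v x) : ℝ) = inner ℝ b (u 1 - u 0) := by
    rw [← huv.setIntegral_eq]
    exact integral_inner huv.integrableOn b
  rw [integral_add (integrableOn_inner_continuousOn hY.integrableOn hvw.continuousOn)
    (hY.integrableOn_inner_left hvw.integrableOn), e3] at e2
  simp only [hu0, hu1, hv0, hv1, sub_zero, inner_zero_right, zero_add] at e2
  rw [e1, e2]

/-- Closure in a Sobolev space by duality with the Hilbert space `∏ L²`. -/
theorem Sobolev.mem_topologicalClosure {k : ℕ} (S : Submodule ℝ (Sobolev f k)) (x : Sobolev f k)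
    (h : ∀ a : Fin (k + 1) → L2 f, (∀ u ∈ S, ∑ i, (inner ℝ (a i) (u.1 i) : ℝ) = 0) →
      ∑ i, (inner ℝ (a i) (x.1 i) : ℝ) = 0) : x ∈ S.topologicalClosure := by
  -- The `ℓ¹` and `ℓ²` products have the same topology; in the latter the closure is the double
  -- orthogonal complement.
  let e : PiLp 1 (fun _ : Fin (k + 1) => L2 f) ≃L[ℝ] PiLp 2 (fun _ : Fin (k + 1) => L2 f) :=
    (PiLp.continuousLinearEquiv 1 ℝ _).trans (PiLp.continuousLinearEquiv 2 ℝ _).symm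
  let g : Sobolev f k →L[ℝ] PiLp 2 (fun _ : Fin (k + 1) => L2 f) :=
    (e : _ →L[ℝ] _).comp (Sobolev f k).subtypeL
  have hg : Topology.IsInducing g := e.toHomeomorph.isInducing.comp Topology.IsInducing.subtypeVal
  have hin : ∀ (a : PiLp 2 (fun _ : Fin (k + 1) => L2 f)) (u : Sobolev f k),
      (inner ℝ a (g u) : ℝ) = ∑ i, (inner ℝ (a i) (u.1 i) : ℝ) :=
    fun a u => PiLp.inner_apply a (g u)
  have hx : g x ∈ (S.map (g : Sobolev f k →ₗ[ℝ] _)).topologicalClosure := by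
    rw [← Submodule.orthogonal_orthogonal_eq_closure, Submodule.mem_orthogonal]
    intro a ha
    rw [hin]
    refine h _ fun u hu => ?_
    rw [← hin, real_inner_comm]
    exact (Submodule.mem_orthogonal _ _).1 ha _ (Submodule.mem_map_of_mem hu)
  rw [← SetLike.mem_coe, Submodule.topologicalClosure_coe] at hx ⊢
  rw [hg.closure_eq_preimage_closure_image]
  exact hx

namespace IsRegularCurve

theorem inner_toL2 (hf : IsRegularCurve 5 f) (u : L2 f) {v : ℝ → EuclideanSpace ℝ (Fin d)}
    (hv : MemLp v 2 (volume.restrict (Icc (0 : ℝ) 1))) :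
    (inner ℝ u (hf.toL2 hv) : ℝ) = ∫ x in Icc (0 : ℝ) 1, ‖velocity f x‖ * inner ℝ (u x) (v x) := by
  rw [L2.inner_def, hf.integral_arcMeasure]
  refine integral_congr_ae ?_
  filter_upwards [hf.coe_toL2 hv] with x hx
  rw [hx]

/-- Expresses boundary values through `L²` pairings, so that they depend continuously on `(u, ∂_s
u)` and pass to the closure defining `H²₀`. -/
theorem inner_add_inner_eq_boundary (hf : IsRegularCurve 5 f) {u v : L2 f}
    {U W Z : ℝ → EuclideanSpace ℝ (Fin d)}
    (hU : IsPrimitive U (fun x => ‖velocity f x‖ • v x))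
    (hu : u =ᵐ[volume.restrict (Icc (0 : ℝ) 1)] U) (hW : IsPrimitive W Z)
    (hZ : ContinuousOn Z (Icc (0 : ℝ) 1)) :
    (inner ℝ v (hf.toL2 (memLp_two_of_continuousOn hW.continuousOn)) : ℝ) +
      inner ℝ u (hf.toL2 (memLp_two_of_continuousOn (hf.inv_speed_continuousOn.smul hZ))) =
    inner ℝ (U 1) (W 1) - inner ℝ (U 0) (W 0) := by
  rw [← hU.integral_inner_by_parts hW, hf.inner_toL2, hf.inner_toL2,
    integral_add (integrableOn_inner_continuousOn hU.integrableOn hW.continuousOn)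
      (hU.integrableOn_inner_left hZ.integrableOn_Icc)]
  congr 1
  · exact integral_congr_ae (.of_forall fun x => by simp only [real_inner_smul_left])
  · refine integral_congr_ae ?_
    filter_upwards [hu, ae_restrict_mem measurableSet_Icc] with x hx hx'
    rw [hx, Pi.smul_apply', inner_smul_right, ← mul_assoc, mul_inv_cancel₀ (hf.speed_pos hx').ne',
      one_mul]

theorem testFields_components (hf : IsRegularCurve 5 f) {u : Sobolev f 2}
    {η : ℝ → EuclideanSpace ℝ (Fin d)} (hη : IsTestField η)
    (hu : u.1 0 =ᵐ[volume.restrict (Icc (0 : ℝ) 1)] η) :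
    u.1 1 =ᵐ[volume.restrict (Icc (0 : ℝ) 1)] fun x => ‖velocity f x‖⁻¹ • deriv η x := by
  obtain ⟨U, h1, h2⟩ := hf.exists_isPrimitive_of_hasWeakDs (u.2 0)
  have := h1.ae_eq_deriv hη.isPrimitive (h2.symm.trans hu)
  filter_upwards [this, ae_restrict_mem measurableSet_Icc] with x hx hx'
  rw [← hx, smul_smul, inv_mul_cancel₀ (hf.speed_pos hx').ne', one_smul]
  rfl

/-- For each weight `W` the boundary term is a continuous functional that vanishes on test fields,
hence on `H²₀`. Affine weights equal to `U 0` or `U 1` at one end and zero at the other isolate the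
two values. -/
theorem boundary_eq_zero (hf : IsRegularCurve 5 f) {φ : Sobolev f 2} (hφ : φ ∈ H20 f) (i : Fin 2)
    {U : ℝ → EuclideanSpace ℝ (Fin d)}
    (hU : IsPrimitive U (fun x => ‖velocity f x‖ • φ.1 i.succ x))
    (hu : φ.1 i.castSucc =ᵐ[volume.restrict (Icc (0 : ℝ) 1)] U) : U 0 = 0 ∧ U 1 = 0 := by
  have key : ∀ W Z : ℝ → EuclideanSpace ℝ (Fin d), IsPrimitive W Z →
      ContinuousOn Z (Icc (0 : ℝ) 1) → (inner ℝ (U 1) (W 1) - inner ℝ (U 0) (W 0) : ℝ) = 0 := by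
    intro W Z hW hZ
    rw [← hf.inner_add_inner_eq_boundary hU hu hW hZ]
    set a := hf.toL2 (memLp_two_of_continuousOn hW.continuousOn) with ha
    set b := hf.toL2 (memLp_two_of_continuousOn (hf.inv_speed_continuousOn.smul hZ)) with hb
    let ℓ : Sobolev f 2 → ℝ := fun ψ => inner ℝ (Sobolev.component f 2 i.succ ψ) a +
      inner ℝ (Sobolev.component f 2 i.castSucc ψ) b
    have hcl : IsClosed {ψ | ℓ ψ = 0} := isClosed_eq (by fun_prop) continuous_const
    have hsub : (H20 f : Set (Sobolev f 2)) ⊆ {ψ | ℓ ψ = 0} := by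
      rw [H20, Submodule.topologicalClosure_coe]
      refine closure_minimal ?_ hcl
      rintro ψ ⟨η, hη, hψ⟩
      obtain ⟨Y, h1, h2⟩ := hf.exists_isPrimitive_of_hasWeakDs (ψ.2 i)
      have hψ' : ψ.1 0 =ᵐ[volume.restrict (Icc (0 : ℝ) 1)] η := hf.ae_iff.1 hψ
      have hY : Y 0 = 0 ∧ Y 1 = 0 := by
        have hc := h1.continuousOn
        fin_cases i
        · have := IsPrimitive.eqOn_of_ae_eq hc hη.continuous.continuousOn (h2.symm.trans hψ')
          rw [this (by simp), this (by simp)]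
          exact ⟨hη.eq_zero (by simp), hη.eq_zero (by simp)⟩
        · have := IsPrimitive.eqOn_of_ae_eq hc
            (hf.inv_speed_continuousOn.smul hη.deriv.continuous.continuousOn)
            (h2.symm.trans (hf.testFields_components hη hψ'))
          rw [this (by simp), this (by simp), Pi.smul_apply', Pi.smul_apply',
            hη.deriv.eq_zero (by simp), hη.deriv.eq_zero (by simp)]
          simp
      have := hf.inner_add_inner_eq_boundary h1 h2 hW hZ
      rw [hY.1, hY.2, inner_zero_left, inner_zero_left, sub_zero] at this
      exact this
    exact hsub hφ
  have hid : IsPrimitive (fun x : ℝ => x) (fun _ => (1 : ℝ)) :=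
    .of_hasDerivAt (fun x _ => hasDerivWithinAt_id x _) continuousOn_const
  constructor
  · have := key (fun x => U 0 + x • (-U 0))
      (fun _ => (0 : EuclideanSpace ℝ (Fin d)) + (1 : ℝ) • (-U 0))
      ((isPrimitive_const _).add (hid.clm ((ContinuousLinearMap.lsmul ℝ ℝ).flip (-U 0))))
      continuousOn_const
    simpa using this
  · have := key (fun x => x • U 1) (fun _ => (1 : ℝ) • U 1)
      (hid.clm ((ContinuousLinearMap.lsmul ℝ ℝ).flip (U 1))) continuousOn_const
    simpa using this

/-- By duality, a functional given by `(a₀, a₁, a₂)` in `L²` that kills test fields must kill `φ`.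
Rewritten in `x`-derivatives, via `∂_s ψ = q ψ'` and `|f_x| ∂_s² ψ = q' ψ' + q ψ''` with `q =
|f_x|⁻¹`, it falls under `integral_eq_zero_of_clamped`. -/
theorem mem_H20 (hf : IsRegularCurve 5 f) {φ : Sobolev f 2} {U V : ℝ → EuclideanSpace ℝ (Fin d)}
    (hU : IsPrimitive U (fun x => ‖velocity f x‖ • φ.1 1 x))
    (hu : φ.1 0 =ᵐ[volume.restrict (Icc (0 : ℝ) 1)] U)
    (hV : IsPrimitive V (fun x => ‖velocity f x‖ • φ.1 2 x))
    (hv : φ.1 1 =ᵐ[volume.restrict (Icc (0 : ℝ) 1)] V)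
    (hU0 : U 0 = 0) (hU1 : U 1 = 0) (hV0 : V 0 = 0) (hV1 : V 1 = 0) : φ ∈ H20 f := by
  refine Sobolev.mem_topologicalClosure _ _ fun a ha => ?_
  obtain ⟨q', hq, hq1, -⟩ := hf.inv_speed_memH.exists_isPrimitive_continuousOn
    hf.inv_speed_continuousOn
  obtain ⟨g, hg, hg1⟩ := hf.speed_memH.exists_isPrimitive hf.speed_continuousOn
  -- the functional in terms of `x`-derivatives
  have expand : ∀ (ψ : Sobolev f 2) (u v w : ℝ → EuclideanSpace ℝ (Fin d)), IsPrimitive u v →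
      IsPrimitive v w → ψ.1 0 =ᵐ[volume.restrict (Icc (0 : ℝ) 1)] u →
      ∑ i, (inner ℝ (a i) (ψ.1 i) : ℝ) = ∫ x in Icc (0 : ℝ) 1,
        (inner ℝ (‖velocity f x‖ • a 0 x) (u x) + inner ℝ (a 1 x + q' x • a 2 x) (v x) +
          inner ℝ (‖velocity f x‖⁻¹ • a 2 x) (w x) : ℝ) := by
    intro ψ u v w huv hvw hψ
    obtain ⟨Y, h1, h2⟩ := hf.exists_isPrimitive_of_hasWeakDs (ψ.2 0)
    obtain ⟨Z, h3, h4⟩ := hf.exists_isPrimitive_of_hasWeakDs (ψ.2 1)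
    have e1 : ψ.1 1 =ᵐ[volume.restrict (Icc (0 : ℝ) 1)] fun x => ‖velocity f x‖⁻¹ • v x := by
      filter_upwards [h1.ae_eq_deriv huv (h2.symm.trans hψ),
        ae_restrict_mem measurableSet_Icc] with x hx hx'
      rw [← hx, smul_smul, inv_mul_cancel₀ (hf.speed_pos hx').ne', one_smul]
      rfl
    have e2 := h3.ae_eq_deriv (hq.bilin (ContinuousLinearMap.lsmul ℝ ℝ) hvw) (h4.symm.trans e1)
    have ii : ∀ i, Integrable (fun x => (inner ℝ (a i x) (ψ.1 i x) : ℝ)) (arcMeasure f) :=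
      fun i => L2.integrable_inner (a i) (ψ.1 i)
    have i01 : Integrable (fun x => (inner ℝ (a 0 x) (ψ.1 0 x) + inner ℝ (a 1 x) (ψ.1 1 x) : ℝ))
      (arcMeasure f) := (ii 0).add (ii 1)
    have e3 : ∑ i, (inner ℝ (a i) (ψ.1 i) : ℝ) = ∫ x, (inner ℝ (a 0 x) (ψ.1 0 x) +
        inner ℝ (a 1 x) (ψ.1 1 x) + inner ℝ (a 2 x) (ψ.1 2 x) : ℝ) ∂(arcMeasure f) := by
      rw [integral_add i01 (ii 2), integral_add (ii 0) (ii 1)]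
      exact Fin.sum_univ_three _
    rw [e3, hf.integral_arcMeasure]
    refine integral_congr_ae ?_
    filter_upwards [hψ, e1, e2, ae_restrict_mem measurableSet_Icc] with x k1 k2 k3 hx'
    have hp := (hf.speed_pos hx').ne'
    have k4 : ‖velocity f x‖ * inner ℝ (a 2 x) (ψ.1 2 x) =
        inner ℝ (a 2 x) (q' x • v x + ‖velocity f x‖⁻¹ • w x) := by
      rw [← inner_smul_right]
      exact congrArg _ k3
    rw [mul_add, mul_add, k4, k1, k2]
    simp only [inner_add_left, inner_add_right, inner_smul_right, real_inner_smul_left]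
    field_simp
    ring
  have m0 : MemH 0 (fun x => ‖velocity f x‖ • a 0 x) :=
    MemH.smul_of_le (l := 3) (by omega) hf.speed_memH (hf.memLp_coe _)
  have m1 : MemH 0 (fun x => a 1 x + q' x • a 2 x) :=
    MemH.add (hf.memLp_coe _) (MemH.smul_of_le (l := 2) (by omega) hq1 (hf.memLp_coe _))
  have m2 : MemH 0 (fun x => ‖velocity f x‖⁻¹ • a 2 x) :=
    MemH.smul_of_le (l := 3) (by omega) hf.inv_speed_memH (hf.memLp_coe _)
  have hD := hg.bilin (ContinuousLinearMap.lsmul ℝ ℝ) hV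
  have hUD : IsPrimitive U (fun x => ContinuousLinearMap.lsmul ℝ ℝ ‖velocity f x‖ (V x)) := by
    refine hU.congr_deriv ?_
    filter_upwards [hv] with x hx
    rw [hx]; rfl
  rw [expand φ U _ _ hUD hD hu]
  refine integral_eq_zero_of_clamped m0.integrableOn m1 m2 (fun η hη => ?_) hUD hD ?_ hU0 hU1
    (by simp [hV0]) (by simp [hV1])
  · obtain ⟨ψ, hψ⟩ := hf.exists_sobolev (k := 2) (by omega) (hf.toL2 (hη.memH 0))
      ((hη.memH 2).congr (hf.coe_toL2 (hη.memH 0)).symm)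
    have hψ' : ψ.1 0 =ᵐ[volume.restrict (Icc (0 : ℝ) 1)] η := hψ ▸ hf.coe_toL2 (hη.memH 0)
    rw [← expand ψ η _ _ hη.isPrimitive hη.deriv.isPrimitive hψ']
    exact ha ψ ⟨η, hη, hf.ae_iff.2 hψ'⟩
  · have n1 : MemH 0 (fun x => ContinuousLinearMap.lsmul ℝ ℝ (g x) (V x)) :=
      MemH.bilin_of_le _ (l := 2) (by omega) hg1 (memLp_two_of_continuousOn hV.continuousOn)
    have n2 : MemH 0 (fun x => ContinuousLinearMap.lsmul ℝ ℝ ‖velocity f x‖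
        (‖velocity f x‖ • φ.1 2 x)) :=
      MemH.bilin_of_le _ (l := 3) (by omega) hf.speed_memH
        (MemH.smul_of_le (k := 0) (l := 3) (by omega) hf.speed_memH (hf.memLp_coe _))
    exact n1.add n2

end IsRegularCurve

end ElasticCurve

/-! ### Linear differential equations and the clamped fourth order problem. -/

namespace ElasticCurve

/-- Global existence for linear ordinary differential equations on `[0,1]`. -/
theorem exists_isPrimitive_linear {X : Type*} [NormedAddCommGroup X] [NormedSpace ℝ X]
    [CompleteSpace X] {A : ℝ → X →L[ℝ] X} (hA : ContinuousOn A (Icc (0 : ℝ) 1)) (x₀ : X) :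
    ∃ u : ℝ → X, IsPrimitive u (fun t => A t (u t)) ∧ u 0 = x₀ := by
  obtain ⟨K, hK⟩ := isCompact_Icc.exists_bound_of_continuousOn hA
  have hK0 : 0 ≤ K := (norm_nonneg _).trans (hK 0 (by simp))
  -- The unknown is rescaled to `Q = e^{-lx} u`; in this weighted norm the Volterra map contracts on
  -- all of `[0,1]`, with constant `K / l = K / (K + 1)`.
  let l : ℝ := K + 1
  have hl : 0 < l := by positivity
  let F : C(Icc (0 : ℝ) 1, X) → ℝ → X := fun Q t =>
    Real.exp (l * t) • A t (IccExtend zero_le_one Q t)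
  have hF : ∀ Q, ContinuousOn (F Q) (Icc (0 : ℝ) 1) := fun Q =>
    (Continuous.continuousOn (by fun_prop)).smul
      (hA.clm_apply (Q.continuous.Icc_extend').continuousOn)
  let W : C(Icc (0 : ℝ) 1, X) → ℝ → X := fun Q x => x₀ + ∫ t in (0 : ℝ)..x, F Q t
  have hW : ∀ Q, IsPrimitive (W Q) (F Q) := fun Q =>
    isPrimitive_const_add_integral (hF Q).integrableOn_Icc x₀
  let V : C(Icc (0 : ℝ) 1, X) → C(Icc (0 : ℝ) 1, X) := fun Q =>
    ⟨(Icc (0 : ℝ) 1).domRestrict fun x => Real.exp (-(l * x)) • W Q x,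
      (ContinuousOn.smul (Continuous.continuousOn (by fun_prop)) (hW Q).continuousOn).domRestrict⟩
  have hκ : ((K / l).toNNReal : ℝ) = K / l := Real.coe_toNNReal _ (by positivity)
  have hV : ContractingWith (K / l).toNNReal V := by
    refine ⟨?_, LipschitzWith.of_dist_le_mul fun P Q => ?_⟩
    · rw [← NNReal.coe_lt_coe, hκ]
      exact (div_lt_one hl).2 (by simp [l])
    · rw [hκ, ContinuousMap.dist_le (by positivity)]
      rintro ⟨x, hx⟩
      change dist (Real.exp (-(l * x)) • W P x) (Real.exp (-(l * x)) • W Q x) ≤ K / l * dist P Q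
      have e1 : W P x - W Q x = ∫ t in (0 : ℝ)..x, (F P t - F Q t) := by
        rw [intervalIntegral.integral_sub (intervalIntegrable_of_integrableOn (hW P).integrableOn hx)
          (intervalIntegrable_of_integrableOn (hW Q).integrableOn hx)]
        simp only [W]; abel
      have e2 : ∫ t in (0 : ℝ)..x, K * dist P Q * Real.exp (l * t) =
          K * dist P Q * (Real.exp (l * x) - 1) / l := by
        rw [intervalIntegral.integral_const_mul, intervalIntegral.integral_comp_mul_left _ hl.ne',
          integral_exp]
        simp only [mul_zero, Real.exp_zero, smul_eq_mul]
        field_simp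
      have e3 : ‖W P x - W Q x‖ ≤ K * dist P Q * (Real.exp (l * x) - 1) / l := by
        rw [e1, ← e2]
        refine intervalIntegral.norm_integral_le_of_norm_le hx.1 (.of_forall fun t ht => ?_)
          (Continuous.intervalIntegrable (by fun_prop) _ _)
        have ht' : t ∈ Icc (0 : ℝ) 1 := ⟨ht.1.le, ht.2.trans hx.2⟩
        simp only [F]
        rw [← smul_sub, ← map_sub, norm_smul, Real.norm_of_nonneg (Real.exp_pos _).le, mul_comm]
        gcongr
        refine ((A t).le_opNorm _).trans ?_
        gcongr
        · exact hK t ht'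
        · rw [IccExtend_of_mem _ _ ht', IccExtend_of_mem _ _ ht', ← dist_eq_norm]
          exact ContinuousMap.dist_apply_le_dist _
      rw [dist_eq_norm, ← smul_sub, norm_smul, Real.norm_of_nonneg (Real.exp_pos _).le]
      calc Real.exp (-(l * x)) * ‖W P x - W Q x‖
          ≤ Real.exp (-(l * x)) * (K * dist P Q * (Real.exp (l * x) - 1) / l) := by gcongr
        _ = K / l * dist P Q * (1 - Real.exp (-(l * x))) := by
          have : Real.exp (-(l * x)) * Real.exp (l * x) = 1 := by rw [← Real.exp_add]; simp
          field_simp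
          linear_combination (K * dist P Q) * this
        _ ≤ K / l * dist P Q * 1 := by
          gcongr
          linarith [Real.exp_pos (-(l * x))]
        _ = K / l * dist P Q := mul_one _
  let Q := hV.fixedPoint V
  have hQ : V Q = Q := hV.fixedPoint_isFixedPt
  refine ⟨W Q, (hW Q).congr_deriv ?_, by simp [W]⟩
  filter_upwards [ae_restrict_mem measurableSet_Icc] with t ht
  have h1 : Q ⟨t, ht⟩ = Real.exp (-(l * t)) • W Q t := by
    conv_lhs => rw [← hQ]
    rfl
  simp only [F]
  rw [IccExtend_of_mem _ _ ht, h1, map_smul, smul_smul, ← Real.exp_add]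
  simp

section ClampedProblem

variable {E : Type*} [NormedAddCommGroup E] [NormedSpace ℝ E] [CompleteSpace E]

theorem IsPrimitive.smul {a b : ℝ → ℝ} {u v : ℝ → E} (h : IsPrimitive a b)
    (h' : IsPrimitive u v) :
    IsPrimitive (fun x => a x • u x) (fun x => b x • u x + a x • v x) :=
  h.bilin (ContinuousLinearMap.lsmul ℝ ℝ) h'

theorem IsPrimitive.smul_const {a b : ℝ → ℝ} (h : IsPrimitive a b) (c : E) :
    IsPrimitive (fun x => a x • c) (fun x => b x • c) :=
  h.clm ((ContinuousLinearMap.lsmul ℝ ℝ).flip c)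

/-- Solution of `w'''' = h` with clamped boundary values, where `'` is the derivative `γ⁻¹ d/dx`
with respect to arc length. The solution satisfies the linear relations that `h` satisfies. -/
theorem exists_clamped_solution {γ : ℝ → ℝ} (hγ : ContinuousOn γ (Icc (0 : ℝ) 1))
    (hpos : ∀ x ∈ Icc (0 : ℝ) 1, 0 < γ x) {h : ℝ → E}
    (hh : IntegrableOn (fun x => γ x • h x) (Icc (0 : ℝ) 1)) (A : E →L[ℝ] ℝ)
    (hA : ∀ᵐ x ∂(volume.restrict (Icc (0 : ℝ) 1)), A (h x) = 0) :
    ∃ w : Fin 4 → ℝ → E, IsPrimitive (w 0) (fun x => γ x • w 1 x) ∧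
      IsPrimitive (w 1) (fun x => γ x • w 2 x) ∧ IsPrimitive (w 2) (fun x => γ x • w 3 x) ∧
      IsPrimitive (w 3) (fun x => γ x • h x) ∧
      (w 0 0 = 0 ∧ w 0 1 = 0 ∧ w 1 0 = 0 ∧ w 1 1 = 0) ∧
      ∀ i, ∀ x ∈ Icc (0 : ℝ) 1, A (w i x) = 0 := by
  have lift : ∀ v : ℝ → E, IntegrableOn (fun x => γ x • v x) (Icc (0 : ℝ) 1) →
      (∀ᵐ x ∂(volume.restrict (Icc (0 : ℝ) 1)), A (v x) = 0) →
      ∃ u : ℝ → E, IsPrimitive u (fun x => γ x • v x) ∧ u 0 = 0 ∧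
        (∀ x ∈ Icc (0 : ℝ) 1, A (u x) = 0) := by
    intro v hv hv'
    have hu := isPrimitive_const_add_integral hv 0
    refine ⟨_, hu, by simp, fun x hx => ?_⟩
    have := (hu.clm A).eqOn_const (by filter_upwards [hv'] with x hx; simp [hx]) hx
    simpa using this
  have int : ∀ u : ℝ → E, ContinuousOn u (Icc (0 : ℝ) 1) →
      IntegrableOn (fun x => γ x • u x) (Icc (0 : ℝ) 1) := fun u hu => (hγ.smul hu).integrableOn_Icc
  have aeA : ∀ u : ℝ → E, (∀ x ∈ Icc (0 : ℝ) 1, A (u x) = 0) →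
      ∀ᵐ x ∂(volume.restrict (Icc (0 : ℝ) 1)), A (u x) = 0 := fun u hu => by
    filter_upwards [ae_restrict_mem measurableSet_Icc] with x hx using hu x hx
  obtain ⟨u3, p3, z3, a3⟩ := lift h hh hA
  obtain ⟨u2, p2, z2, a2⟩ := lift u3 (int _ p3.continuousOn) (aeA _ a3)
  obtain ⟨u1, p1, z1, a1⟩ := lift u2 (int _ p2.continuousOn) (aeA _ a2)
  obtain ⟨u0, p0, z0, a0⟩ := lift u1 (int _ p1.continuousOn) (aeA _ a1)
  have ps := isPrimitive_const_add_integral hγ.integrableOn_Icc 0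
  set s := fun x => (0 : ℝ) + ∫ t in (0 : ℝ)..x, γ t with hs
  have s0 : s 0 = 0 := by simp [hs]
  have ps2 : IsPrimitive (fun x => s x ^ 2 / 2) (fun x => γ x * s x) := by
    have := (ps.smul ps).smul_const (1 / 2 : ℝ)
    refine (this.congr_left fun x _ => ?_).congr_deriv (.of_forall fun x => ?_)
    · simp only [smul_eq_mul]; ring
    · simp only [smul_eq_mul]; ring
  have ps3 : IsPrimitive (fun x => s x ^ 3 / 6) (fun x => γ x * (s x ^ 2 / 2)) := by
    have := (ps.smul ps2).smul_const (1 / 3 : ℝ)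
    refine (this.congr_left fun x _ => ?_).congr_deriv (.of_forall fun x => ?_)
    · simp only [smul_eq_mul]; ring
    · simp only [smul_eq_mul]; ring
  have hL : 0 < s 1 := by
    simp only [hs, zero_add]
    exact intervalIntegral.intervalIntegral_pos_of_pos_on
      (intervalIntegrable_of_integrableOn hγ.integrableOn_Icc (by simp))
      (fun x hx => hpos x (Ioo_subset_Icc_self hx)) zero_lt_one
  set L := s 1 with hLdef
  -- The iterated integrals are clamped at `0`. Adding `(s²/2) c2 + (s³/6) c3` keeps this and leaves
  -- the fourth derivative unchanged; `c2`, `c3` solve the two equations for value and slope at `s =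
  -- L`. They are combinations of `u0 1` and `u1 1`, so `A` kills them too.
  set c3 : E := (12 / L ^ 3) • u0 1 - (6 / L ^ 2) • u1 1 with hc3
  set c2 : E := (2 / L) • u1 1 - (6 / L ^ 2) • u0 1 with hc2
  have ac3 : A c3 = 0 := by simp [hc3, a0 1, a1 1]
  have ac2 : A c2 = 0 := by simp [hc2, a0 1, a1 1]
  refine ⟨![fun x => u0 x + ((s x ^ 2 / 2) • c2 + (s x ^ 3 / 6) • c3),
    fun x => u1 x + (s x • c2 + (s x ^ 2 / 2) • c3), fun x => u2 x + (c2 + s x • c3),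
    fun x => u3 x + c3], ?_, ?_, ?_, ?_, ⟨?_, ?_, ?_, ?_⟩, ?_⟩
  · refine (p0.add ((ps2.smul_const c2).add (ps3.smul_const c3))).congr_deriv
      (.of_forall fun x => ?_)
    simp [smul_add, smul_smul]
  · refine (p1.add ((ps.smul_const c2).add (ps2.smul_const c3))).congr_deriv
      (.of_forall fun x => ?_)
    simp [smul_add, smul_smul]
  · refine (p2.add ((isPrimitive_const c2).add (ps.smul_const c3))).congr_deriv
      (.of_forall fun x => ?_)
    simp [smul_add]
  · refine (p3.add (isPrimitive_const c3)).congr_deriv (.of_forall fun x => ?_)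
    simp
  · simp [z0, s0]
  · simp only [Matrix.cons_val_zero, ← hLdef, hc2, hc3]
    match_scalars <;> field_simp <;> ring
  · simp [z1, s0]
  · simp only [Matrix.cons_val_one, Matrix.cons_val_zero, ← hLdef, hc2, hc3]
    match_scalars <;> field_simp <;> ring
  · intro i x hx
    fin_cases i <;> simp [a0 x hx, a1 x hx, a2 x hx, a3 x hx, ac2, ac3]

end ClampedProblem

end ElasticCurve

/-! ### The normal connection: parallel transport, energy identity, solvability. -/

namespace ElasticCurve

namespace IsRegularCurve

variable {d : ℕ} {f : ℝ → EuclideanSpace ℝ (Fin d)}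

theorem mem_L2Normal_iff (hf : IsRegularCurve 5 f) {u : L2 f} :
    u ∈ L2Normal f ↔ ∀ᵐ x ∂(volume.restrict (Icc (0 : ℝ) 1)),
      (inner ℝ (unitTangent f x) (u x) : ℝ) = 0 := by
  rw [← hf.ae_iff]
  change (∀ᵐ x ∂(arcMeasure f), (inner ℝ (u x) (velocity f x) : ℝ) = 0) ↔ _
  rw [hf.ae_iff, hf.ae_iff]
  refine Filter.eventually_congr ?_
  filter_upwards [ae_restrict_mem measurableSet_Icc] with x hx
  rw [unitTangent, real_inner_smul_left, real_inner_comm, mul_eq_zero,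
    or_iff_right (inv_ne_zero (hf.speed_pos hx).ne')]

/-- Orthogonality comes from differentiating `|τ|² = 1`. Here `κ` is the `x`-derivative of the
tangent, that is, the curvature vector times `|f_x|`. -/
theorem exists_deriv_unitTangent (hf : IsRegularCurve 5 f) :
    ∃ κ : ℝ → EuclideanSpace ℝ (Fin d), IsPrimitive (unitTangent f) κ ∧ MemH 3 κ ∧
      ContinuousOn κ (Icc (0 : ℝ) 1) ∧
      ∀ x ∈ Icc (0 : ℝ) 1, (inner ℝ (unitTangent f x) (κ x) : ℝ) = 0 := by
  obtain ⟨κ, h1, h2, h3⟩ := hf.unitTangent_memH.exists_isPrimitive_continuousOn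
    hf.unitTangent_continuousOn
  refine ⟨κ, h1, h2, h3, fun x hx => ?_⟩
  have d1 := h1.hasDerivWithinAt h3 hx
  have d2 := d1.inner ℝ d1
  have d3 : HasDerivWithinAt (fun t => (inner ℝ (unitTangent f t) (unitTangent f t) : ℝ)) 0
      (Icc 0 1) x := by
    refine (hasDerivWithinAt_const x (Icc (0 : ℝ) 1) (1 : ℝ)).congr (fun t ht => ?_) ?_
    · rw [real_inner_self_eq_norm_sq, hf.norm_unitTangent ht, one_pow]
    · rw [real_inner_self_eq_norm_sq, hf.norm_unitTangent hx, one_pow]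
  have := (uniqueDiffOn_Icc zero_lt_one x hx).eq_deriv _ d2 d3
  rw [real_inner_comm (κ x)] at this
  rw [real_inner_comm]
  linarith

/-- Parallel transport along the curve, with respect to the normal connection: the fields `R v`
have vanishing normal derivative if `v` is normal to the curve at `0`. -/
theorem exists_parallel_transport (hf : IsRegularCurve 5 f) :
    ∃ (κ : ℝ → EuclideanSpace ℝ (Fin d))
      (A R : ℝ → EuclideanSpace ℝ (Fin d) →L[ℝ] EuclideanSpace ℝ (Fin d)),
      ContinuousOn κ (Icc (0 : ℝ) 1) ∧ (∀ x v, A x v = (inner ℝ (unitTangent f x) v : ℝ) • κ x -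
        (inner ℝ (κ x) v : ℝ) • unitTangent f x) ∧ ContinuousOn A (Icc (0 : ℝ) 1) ∧
      MemH 4 R ∧ IsPrimitive R (fun x => (A x).comp (R x)) ∧
      (∀ x ∈ Icc (0 : ℝ) 1, ∀ v w, (inner ℝ (R x v) (R x w) : ℝ) = inner ℝ v w) ∧
      ∀ x ∈ Icc (0 : ℝ) 1, ∀ v,
        (inner ℝ (unitTangent f x) (R x v) : ℝ) = inner ℝ (unitTangent f 0) v := by
  obtain ⟨κ, k1, k2, k3, k4⟩ := hf.exists_deriv_unitTangent
  let B : EuclideanSpace ℝ (Fin d) →L[ℝ] EuclideanSpace ℝ (Fin d) →L[ℝ]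
      EuclideanSpace ℝ (Fin d) →L[ℝ] EuclideanSpace ℝ (Fin d) :=
    (ContinuousLinearMap.smulRightL ℝ (EuclideanSpace ℝ (Fin d)) (EuclideanSpace ℝ (Fin d))).comp
      (innerSL ℝ)
  -- `A` is skew, so its flow is isometric; `A τ = κ = τ'`, so the flow preserves the inner product
  -- with `τ`; and `A` sends normal vectors to tangential ones, which `∇_s` discards.
  let A : ℝ → EuclideanSpace ℝ (Fin d) →L[ℝ] EuclideanSpace ℝ (Fin d) := fun x =>
    B (unitTangent f x) (κ x) - B (κ x) (unitTangent f x)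
  have hA : ∀ x v, A x v = (inner ℝ (unitTangent f x) v : ℝ) • κ x -
        (inner ℝ (κ x) v : ℝ) • unitTangent f x := fun x v => rfl
  have mA : MemH 3 A := (MemH.bilin B (hf.unitTangent_memH.mono (by omega)) k2).sub
    (MemH.bilin B k2 (hf.unitTangent_memH.mono (by omega)))
  have cA : ContinuousOn A (Icc (0 : ℝ) 1) :=
    ((B.continuous.comp_continuousOn hf.unitTangent_continuousOn).clm_apply k3).sub
      ((B.continuous.comp_continuousOn k3).clm_apply hf.unitTangent_continuousOn)
  let C := ContinuousLinearMap.compL ℝ (EuclideanSpace ℝ (Fin d)) (EuclideanSpace ℝ (Fin d))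
    (EuclideanSpace ℝ (Fin d))
  obtain ⟨R, hR, hR0⟩ := exists_isPrimitive_linear (A := fun x => C (A x))
    (C.continuous.comp_continuousOn cA) (ContinuousLinearMap.id ℝ _)
  have mR : ∀ k ≤ 3, MemH (k + 1) R := by
    intro k hk
    induction k with
    | zero => exact .of_isPrimitive hR (memLp_two_of_continuousOn
        ((C.continuous.comp_continuousOn cA).clm_apply hR.continuousOn))
    | succ k ih => exact .of_isPrimitive hR (MemH.bilin C (mA.mono (by omega)) (ih (by omega)))
  have hRv : ∀ v, IsPrimitive (fun x => R x v) (fun x => A x (R x v)) := fun v =>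
    hR.clm (ContinuousLinearMap.apply ℝ (EuclideanSpace ℝ (Fin d)) v)
  refine ⟨κ, A, R, k3, hA, cA, mR 3 le_rfl, hR, fun x hx v w => ?_, fun x hx v => ?_⟩
  · have := ((hRv v).real_inner (hRv w)).eqOn_const (.of_forall fun t => by
      simp only [hA, inner_sub_left, inner_sub_right, real_inner_smul_left,
        inner_smul_right, Pi.zero_apply, real_inner_comm (R t v)]
      ring) hx
    simpa [hR0] using this
  · have := (k1.real_inner (hRv v)).eqOn_const (by
      filter_upwards [ae_restrict_mem measurableSet_Icc] with t ht
      have h1 : (inner ℝ (unitTangent f t) (unitTangent f t) : ℝ) = 1 := by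
        rw [real_inner_self_eq_norm_sq, hf.norm_unitTangent ht, one_pow]
      simp only [hA, inner_sub_right, inner_smul_right, k4 t ht, h1,
        Pi.zero_apply]
      ring) hx
    simpa [hR0] using this

/-- Metric compatibility: `∇_s` differs from `∂_s` by a tangential term, which is orthogonal to the
other, normal, factor. -/
theorem inner_isPrimitive (hf : IsRegularCurve 5 f) {χ χ' ψ ψ' : L2 f} (hχ : HasNablaS f χ χ')
    (hψ : HasNablaS f ψ ψ') (nχ : χ ∈ L2Normal f) (nψ : ψ ∈ L2Normal f)
    {X Y : ℝ → EuclideanSpace ℝ (Fin d)} (hX : ContinuousOn X (Icc (0 : ℝ) 1))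
    (hY : ContinuousOn Y (Icc (0 : ℝ) 1)) (eX : χ =ᵐ[volume.restrict (Icc (0 : ℝ) 1)] X)
    (eY : ψ =ᵐ[volume.restrict (Icc (0 : ℝ) 1)] Y) :
    IsPrimitive (fun x => (inner ℝ (X x) (Y x) : ℝ))
      (fun x => ‖velocity f x‖ * inner ℝ (χ' x) (ψ x) + ‖velocity f x‖ * inner ℝ (χ x) (ψ' x)) := by
  obtain ⟨v, hv, hv'⟩ := hχ
  obtain ⟨w, hw, hw'⟩ := hψ
  obtain ⟨V, v1, v2⟩ := hf.exists_isPrimitive_of_hasWeakDs hv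
  obtain ⟨W, w1, w2⟩ := hf.exists_isPrimitive_of_hasWeakDs hw
  have p1 := v1.congr_left (IsPrimitive.eqOn_of_ae_eq hX v1.continuousOn (eX.symm.trans v2))
  have p2 := w1.congr_left (IsPrimitive.eqOn_of_ae_eq hY w1.continuousOn (eY.symm.trans w2))
  refine (p1.real_inner p2).congr_deriv ?_
  filter_upwards [hf.ae_iff.1 hv', hf.ae_iff.1 hw', hf.mem_L2Normal_iff.1 nχ,
    hf.mem_L2Normal_iff.1 nψ, eX, eY] with x h1 h2 h3 h4 h5 h6
  rw [h1, h2, ← h5, ← h6, inner_sub_left, inner_sub_right,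
    real_inner_smul_left, inner_smul_right, real_inner_smul_left, inner_smul_right, h4,
    real_inner_comm (unitTangent f x) (χ x), h3]
  ring

theorem integral_inner (hf : IsRegularCurve 5 f) (u v : L2 f) :
    (inner ℝ u v : ℝ) = ∫ x in Icc (0 : ℝ) 1, ‖velocity f x‖ * inner ℝ (u x) (v x) := by
  rw [L2.inner_def, hf.integral_arcMeasure]

theorem integrableOn_inner (hf : IsRegularCurve 5 f) (u v : L2 f) :
    IntegrableOn (fun x => ‖velocity f x‖ * inner ℝ (u x) (v x)) (Icc (0 : ℝ) 1) := by
  have : MemLp (fun x => ‖velocity f x‖ • u x) 2 (volume.restrict (Icc (0 : ℝ) 1)) :=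
    MemH.smul_of_le (l := 3) (k := 0) (by omega) hf.speed_memH (hf.memLp_coe u)
  refine (memLp_one_iff_integrable.1 ((innerSL ℝ).memLp_of_bilin 1 this (hf.memLp_coe v))).congr
    (.of_forall fun x => ?_)
  change (inner ℝ (‖velocity f x‖ • u x) (v x) : ℝ) = _
  rw [real_inner_smul_left]

/-- Only one factor has to vanish at the ends. This matters because nothing is known about the
boundary values of `∇_s² φ` and `∇_s³ φ`. -/
theorem inner_nablaS_by_parts (hf : IsRegularCurve 5 f) {χ χ' ψ ψ' : L2 f}
    (hχ : HasNablaS f χ χ') (hψ : HasNablaS f ψ ψ') (nχ : χ ∈ L2Normal f) (nψ : ψ ∈ L2Normal f)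
    {X Y : ℝ → EuclideanSpace ℝ (Fin d)} (hX : ContinuousOn X (Icc (0 : ℝ) 1))
    (hY : ContinuousOn Y (Icc (0 : ℝ) 1)) (eX : χ =ᵐ[volume.restrict (Icc (0 : ℝ) 1)] X)
    (eY : ψ =ᵐ[volume.restrict (Icc (0 : ℝ) 1)] Y) (hY0 : Y 0 = 0) (hY1 : Y 1 = 0) :
    (inner ℝ χ' ψ : ℝ) + inner ℝ χ ψ' = 0 := by
  have := (hf.inner_isPrimitive hχ hψ nχ nψ hX hY eX eY).setIntegral_eq
  rw [integral_add (hf.integrableOn_inner _ _) (hf.integrableOn_inner _ _), ← hf.integral_inner,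
    ← hf.integral_inner, hY0, hY1] at this
  simpa using this

theorem eq_zero_of_hasNablaS_zero (hf : IsRegularCurve 5 f) {χ : L2 f} (h : HasNablaS f χ 0)
    (n : χ ∈ L2Normal f) {X : ℝ → EuclideanSpace ℝ (Fin d)} (hX : ContinuousOn X (Icc (0 : ℝ) 1))
    (eX : χ =ᵐ[volume.restrict (Icc (0 : ℝ) 1)] X) (hX0 : X 0 = 0) : χ = 0 := by
  have h1 := (hf.inner_isPrimitive h h n n hX hX eX eX).eqOn_const (by
    filter_upwards [hf.ae_iff.1 (Lp.coeFn_zero (EuclideanSpace ℝ (Fin d)) 2 (arcMeasure f))]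
      with x hx
    rw [hx, Pi.zero_apply, inner_zero_left, inner_zero_right, mul_zero, add_zero]
    rfl)
  refine hf.ext_ae ?_
  filter_upwards [hf.ae_iff.1 (Lp.coeFn_zero (EuclideanSpace ℝ (Fin d)) 2 (arcMeasure f)), eX,
    ae_restrict_mem measurableSet_Icc] with x h2 h3 h4
  have h5 := h1 h4
  simp only [hX0, inner_zero_left] at h5
  rw [h2, h3, inner_self_eq_zero.1 h5, Pi.zero_apply]

theorem exists_continuousOn_of_hasNablaS (hf : IsRegularCurve 5 f) {χ ψ : L2 f}
    (h : HasNablaS f χ ψ) : ∃ X : ℝ → EuclideanSpace ℝ (Fin d), ContinuousOn X (Icc (0 : ℝ) 1) ∧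
      χ =ᵐ[volume.restrict (Icc (0 : ℝ) 1)] X := by
  obtain ⟨v, hv, -⟩ := h
  obtain ⟨X, h1, h2⟩ := hf.exists_isPrimitive_of_hasWeakDs hv
  exact ⟨X, h1.continuousOn, h2⟩

theorem eq_zero_of_iterNablaS_eq_zero (hf : IsRegularCurve 5 f) {φ : Sobolev f 4}
    (hφ : φ ∈ H4cNormal f) (h : HasIterNablaS f 4 (φ.1 0) 0) : φ = 0 := by
  obtain ⟨hc, hn⟩ := hφ
  have n0 : φ.1 0 ∈ L2Normal f := hn
  obtain ⟨χ3, ⟨χ2, ⟨χ1, ⟨χ0, h00, h1⟩, h2⟩, h3⟩, h4⟩ := h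
  have h0 : χ0 = φ.1 0 := h00
  subst h0
  have n1 := hf.mem_L2Normal_of_hasNablaS h1
  have n2 := hf.mem_L2Normal_of_hasNablaS h2
  have n3 := hf.mem_L2Normal_of_hasNablaS h3
  obtain ⟨U, u1, u2⟩ := hf.exists_isPrimitive_of_hasWeakDs (φ.2 0)
  obtain ⟨V, v1, v2⟩ := hf.exists_isPrimitive_of_hasWeakDs (φ.2 1)
  obtain ⟨hU0, hU1⟩ := hf.boundary_eq_zero hc 0 u1 u2
  obtain ⟨hV0, hV1⟩ := hf.boundary_eq_zero hc 1 v1 v2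
  obtain ⟨X2, c2, e2⟩ := hf.exists_continuousOn_of_hasNablaS h3
  obtain ⟨X3, c3, e3⟩ := hf.exists_continuousOn_of_hasNablaS h4
  let X1 : ℝ → EuclideanSpace ℝ (Fin d) := fun x =>
    V x - (inner ℝ (V x) (unitTangent f x) : ℝ) • unitTangent f x
  have ci : ContinuousOn (fun x => (inner ℝ (V x) (unitTangent f x) : ℝ)) (Icc (0 : ℝ) 1) :=
    v1.continuousOn.inner hf.unitTangent_continuousOn
  have c1 : ContinuousOn X1 (Icc (0 : ℝ) 1) :=
    v1.continuousOn.sub (ci.smul hf.unitTangent_continuousOn)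
  have e1 : χ1 =ᵐ[volume.restrict (Icc (0 : ℝ) 1)] X1 := by
    rw [(hf.hasNablaS_iff (φ.2 0)).1 h1]
    filter_upwards [hf.coe_normalProj (φ.1 (Fin.succ 0)), v2] with x k1 k2
    have k2' : φ.1 (Fin.succ 0) x = V x := k2
    rw [k1, k2']
  have X10 : X1 0 = 0 := by simp [X1, hV0]
  have X11 : X1 1 = 0 := by simp [X1, hV1]
  -- The energy identity: `0 = ⟨∇_s⁴ φ, φ⟩ = -⟨∇_s³ φ, ∇_s φ⟩ = ‖∇_s² φ‖²`.
  have s1 := hf.inner_nablaS_by_parts h4 h1 n3 n0 c3 u1.continuousOn e3 u2 hU0 hU1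
  rw [inner_zero_left, zero_add] at s1
  have s2 := hf.inner_nablaS_by_parts h3 h2 n2 n1 c2 c1 e2 e1 X10 X11
  rw [s1, zero_add] at s2
  have z2 : χ2 = 0 := inner_self_eq_zero.1 s2
  subst z2
  have z1 := hf.eq_zero_of_hasNablaS_zero h2 n1 c1 e1 X10
  subst z1
  have z0 := hf.eq_zero_of_hasNablaS_zero h1 n0 u1.continuousOn u2 hU0
  exact hf.sobolev_ext z0

/-- Conjugation by `R` turns `∇_s` on normal fields into `∂_s` on fields orthogonal to `τ(0)`, so
the solution is `R w` with `∂_s⁴ w = R⁻¹ g` clamped. -/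
theorem exists_iterNablaS_eq (hf : IsRegularCurve 5 f) {g : L2 f} (hg : g ∈ L2Normal f) :
    ∃ φ ∈ H4cNormal f, HasIterNablaS f 4 (φ.1 0) g := by
  obtain ⟨κ, A, R, cκ, hA, cA, mR, hR, hiso, htan⟩ := hf.exists_parallel_transport
  have hgn := hf.mem_L2Normal_iff.1 hg
  -- the inverse of the parallel transport
  let S : ℝ → EuclideanSpace ℝ (Fin d) →L[ℝ] EuclideanSpace ℝ (Fin d) := fun x =>
    ContinuousLinearMap.adjoint (R x)
  have cS : ContinuousOn S (Icc (0 : ℝ) 1) :=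
    ContinuousLinearMap.adjoint.continuous.comp_continuousOn hR.continuousOn
  have hRS : ∀ x ∈ Icc (0 : ℝ) 1, ∀ v, R x (S x v) = v := by
    intro x hx v
    -- The isometry property gives only a left inverse; finite dimension makes it two-sided.
    have h1 : (S x).toLinearMap * (R x).toLinearMap = 1 := by
      ext1 w
      refine ext_inner_right ℝ fun z => ?_
      change (inner ℝ (ContinuousLinearMap.adjoint (R x) (R x w)) z : ℝ) = inner ℝ w z
      rw [ContinuousLinearMap.adjoint_inner_left, hiso x hx]
    exact LinearMap.congr_fun (mul_eq_one_comm.1 h1) v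
  let ev : (EuclideanSpace ℝ (Fin d) →L[ℝ] EuclideanSpace ℝ (Fin d)) →L[ℝ]
      EuclideanSpace ℝ (Fin d) →L[ℝ] EuclideanSpace ℝ (Fin d) := ContinuousLinearMap.id ℝ _
  let h : ℝ → EuclideanSpace ℝ (Fin d) := fun x => S x (g x)
  have mh : MemH 0 h := by
    obtain ⟨C, hC⟩ := isCompact_Icc.exists_bound_of_continuousOn cS
    have : MemLp S ⊤ (volume.restrict (Icc (0 : ℝ) 1)) :=
      memLp_top_of_bound (cS.aestronglyMeasurable measurableSet_Icc) C
        (by filter_upwards [ae_restrict_mem measurableSet_Icc] with x hx using hC x hx)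
    exact ev.memLp_of_bilin 2 this (hf.memLp_coe g)
  obtain ⟨w, w0, w1, w2, w3, ⟨b00, b01, b10, b11⟩, hwn⟩ := exists_clamped_solution
    hf.speed_continuousOn (fun x hx => hf.speed_pos hx) (hf.integrableOn_speed_smul mh)
    (innerSL ℝ (unitTangent f 0)) (by
      filter_upwards [hgn, ae_restrict_mem measurableSet_Icc] with x h1 h2
      rw [innerSL_apply_apply, ← htan x h2, hRS x h2, h1])
  have mw3 : MemH 1 (w 3) :=
    .of_isPrimitive w3 (MemH.smul_of_le (l := 3) (by omega) hf.speed_memH mh)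
  have mw2 : MemH 2 (w 2) :=
    .of_isPrimitive w2 (MemH.smul_of_le (l := 3) (by omega) hf.speed_memH mw3)
  have mw1 : MemH 3 (w 1) :=
    .of_isPrimitive w1 (MemH.smul_of_le (l := 3) (by omega) hf.speed_memH mw2)
  have mw0 : MemH 4 (w 0) :=
    .of_isPrimitive w0 (MemH.smul_of_le (l := 3) (by omega) hf.speed_memH mw1)
  have cw : ∀ i, ContinuousOn (w i) (Icc (0 : ℝ) 1) := by
    intro i
    fin_cases i
    exacts [w0.continuousOn, w1.continuousOn, w2.continuousOn, w3.continuousOn]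
  let Φ : Fin 4 → ℝ → EuclideanSpace ℝ (Fin d) := fun i x => R x (w i x)
  have cΦ : ∀ i, ContinuousOn (Φ i) (Icc (0 : ℝ) 1) := fun i => hR.continuousOn.clm_apply (cw i)
  have nΦ : ∀ i, ∀ x ∈ Icc (0 : ℝ) 1, (inner ℝ (unitTangent f x) (Φ i x) : ℝ) = 0 :=
    fun i x hx => (htan x hx _).trans (hwn i x hx)
  -- the covariant derivative of a transported field
  have step : ∀ (i : Fin 4) (v : ℝ → EuclideanSpace ℝ (Fin d)) (χ ψ : L2 f),
      IsPrimitive (w i) (fun x => ‖velocity f x‖ • v x) →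
      χ =ᵐ[volume.restrict (Icc (0 : ℝ) 1)] Φ i →
      ψ =ᵐ[volume.restrict (Icc (0 : ℝ) 1)] (fun x => R x (v x)) → ψ ∈ L2Normal f →
      HasNablaS f χ ψ ∧ ∀ z : L2 f, HasWeakDs f χ z →
        z =ᵐ[volume.restrict (Icc (0 : ℝ) 1)]
          fun x => ψ x - ‖velocity f x‖⁻¹ • (inner ℝ (κ x) (Φ i x) : ℝ) • unitTangent f x := by
    intro i v χ ψ hw hχ hψ nψ
    -- `(R w)' = A R w + |f_x| R v`. As `R w` is normal, `A R w` is tangential, and what survives in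
    -- `∇_s (R w)` is `R v`.
    have hp := hR.bilin ev hw
    have mv : MemH 0 (fun x => ‖velocity f x‖⁻¹ • A x (Φ i x)) :=
      MemH.smul_of_le (l := 3) (by omega) hf.inv_speed_memH
        (memLp_two_of_continuousOn (cA.clm_apply (cΦ i)))
    have mz : MemH 0 (fun x => ψ x + ‖velocity f x‖⁻¹ • A x (Φ i x)) :=
      MemH.add (hf.memLp_coe ψ) mv
    have hz : HasWeakDs f χ (hf.toL2 mz) := by
      refine hf.hasWeakDs_of_isPrimitive (hp.congr_deriv ?_) hχ
      filter_upwards [hf.coe_toL2 mz, hψ, ae_restrict_mem measurableSet_Icc] with x k1 k2 k3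
      rw [k1, k2, smul_add, smul_smul, mul_inv_cancel₀ (hf.speed_pos k3).ne', one_smul, add_comm]
      simp [ev, Φ]
    have ez : hf.toL2 mz =ᵐ[volume.restrict (Icc (0 : ℝ) 1)]
        fun x => ψ x - ‖velocity f x‖⁻¹ • (inner ℝ (κ x) (Φ i x) : ℝ) • unitTangent f x := by
      filter_upwards [hf.coe_toL2 mz, ae_restrict_mem measurableSet_Icc] with x k1 k3
      rw [k1, hA, nΦ i x k3, zero_smul, zero_sub, smul_neg, sub_eq_add_neg]
    refine ⟨⟨_, hz, hf.ae_iff.2 ?_⟩, fun z hz' => hf.hasWeakDs_unique hz hz' ▸ ez⟩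
    filter_upwards [ez, hf.mem_L2Normal_iff.1 nψ, ae_restrict_mem measurableSet_Icc] with x k1 k2 k3
    have h1 : (inner ℝ (unitTangent f x) (unitTangent f x) : ℝ) = 1 := by
      rw [real_inner_self_eq_norm_sq, hf.norm_unitTangent k3, one_pow]
    rw [k1, inner_sub_left, real_inner_smul_left, real_inner_smul_left, h1,
      real_inner_comm (unitTangent f x) (ψ x), k2, zero_sub, mul_one, neg_smul, mul_smul]
    abel
  let χ : Fin 4 → L2 f := fun i => hf.toL2 (memLp_two_of_continuousOn (cΦ i))
  have eχ : ∀ i, χ i =ᵐ[volume.restrict (Icc (0 : ℝ) 1)] Φ i := fun i => hf.coe_toL2 _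
  have nχ : ∀ i, χ i ∈ L2Normal f := fun i => by
    rw [hf.mem_L2Normal_iff]
    filter_upwards [eχ i, ae_restrict_mem measurableSet_Icc] with x k1 k2
    rw [k1, nΦ i x k2]
  have t0 := step 0 (w 1) (χ 0) (χ 1) w0 (eχ 0) (eχ 1) (nχ 1)
  have t1 := step 1 (w 2) (χ 1) (χ 2) w1 (eχ 1) (eχ 2) (nχ 2)
  have t2 := step 2 (w 3) (χ 2) (χ 3) w2 (eχ 2) (eχ 3) (nχ 3)
  have t3 := step 3 h (χ 3) g w3 (eχ 3) (by
    filter_upwards [ae_restrict_mem measurableSet_Icc] with x hx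
    rw [hRS x hx]) hg
  obtain ⟨φ, hφ⟩ := hf.exists_sobolev (k := 4) (by omega) (χ 0)
    ((MemH.bilin ev mR mw0).congr (eχ 0).symm)
  refine ⟨φ, ⟨?_, ?_⟩, ?_⟩
  · obtain ⟨U, u1, u2⟩ := hf.exists_isPrimitive_of_hasWeakDs (φ.2 0)
    obtain ⟨V, v1, v2⟩ := hf.exists_isPrimitive_of_hasWeakDs (φ.2 1)
    have u2' : χ 0 =ᵐ[volume.restrict (Icc (0 : ℝ) 1)] U := hφ ▸ u2
    have hU := IsPrimitive.eqOn_of_ae_eq u1.continuousOn (cΦ 0) (u2'.symm.trans (eχ 0))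
    have hz := t0.2 (φ.1 1) (hφ ▸ φ.2 0)
    -- The continuous representative of `∂_s φ`. Its tangential part involves only `φ` itself, so it
    -- vanishes at the ends because `w 0` and `w 1` do.
    let Z : ℝ → EuclideanSpace ℝ (Fin d) := fun x =>
      Φ 1 x - ‖velocity f x‖⁻¹ • (inner ℝ (κ x) (Φ 0 x) : ℝ) • unitTangent f x
    have hVZ : V =ᵐ[volume.restrict (Icc (0 : ℝ) 1)] Z := by
      filter_upwards [v2, hz, eχ 1] with x k1 k2 k3
      rw [← k1]
      refine Eq.trans k2 ?_
      rw [k3]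
    have ci : ContinuousOn (fun x => (inner ℝ (κ x) (Φ 0 x) : ℝ)) (Icc (0 : ℝ) 1) :=
      cκ.inner (cΦ 0)
    have cZ : ContinuousOn Z (Icc (0 : ℝ) 1) :=
      (cΦ 1).sub (hf.inv_speed_continuousOn.smul (ci.smul hf.unitTangent_continuousOn))
    have hV := IsPrimitive.eqOn_of_ae_eq v1.continuousOn cZ hVZ
    refine hf.mem_H20 (φ := Sobolev.toH2 f φ) u1 u2 v1 v2 ?_ ?_ ?_ ?_
    · rw [hU (by simp)]; simp [Φ, b00]
    · rw [hU (by simp)]; simp [Φ, b01]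
    · rw [hV (by simp)]; simp [Z, Φ, b00, b10]
    · rw [hV (by simp)]; simp [Z, Φ, b01, b11]
  · change φ.1 0 ∈ L2Normal f
    rw [hφ]
    exact nχ 0
  · exact ⟨χ 3, ⟨χ 2, ⟨χ 1, ⟨φ.1 0, rfl, hφ ▸ t0.1⟩, t1.1⟩, t2.1⟩, t3.1⟩

end IsRegularCurve

end ElasticCurve

/-! ### From bijectivity to the Fredholm property. -/

theorem ContinuousLinearMap.isFredholm_of_bijective {X Y : Type*} [NormedAddCommGroup X]
    [NormedSpace ℝ X] [CompleteSpace X] [NormedAddCommGroup Y] [NormedSpace ℝ Y] [CompleteSpace Y]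
    (T : X →L[ℝ] Y) (h : Function.Bijective T) : T.IsFredholm := by
  let e := ContinuousLinearEquiv.ofBijective T (LinearMap.ker_eq_bot.2 h.1)
    (LinearMap.range_eq_top.2 h.2)
  exact .of_isQuasiInverse (v := (e.symm : Y →L[ℝ] X)) e.toLinearEquiv.isQuasiInverse

namespace ElasticCurve

variable {d : ℕ} {f : ℝ → EuclideanSpace ℝ (Fin d)}

theorem fredholmIndex_of_bijective {X Y : Type*} [AddCommGroup X] [Module ℝ X] [TopologicalSpace X]
    [AddCommGroup Y] [Module ℝ Y] [TopologicalSpace Y] (T : X →L[ℝ] Y)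
    (h : Function.Bijective T) : fredholmIndex T = 0 := by
  have h1 : T.ker = ⊥ := LinearMap.ker_eq_bot.2 h.1
  have h2 : T.range = ⊤ := LinearMap.range_eq_top.2 h.2
  have : Subsingleton (Y ⧸ T.range) := by
    rw [h2]; exact Submodule.Quotient.subsingleton_iff.2 rfl
  rw [fredholmIndex, h1, finrank_bot, Module.finrank_zero_of_subsingleton, sub_self]

/-- Normal fields are the fixed points of the continuous normal projection. Closedness gives the
completeness that the open mapping theorem requires. -/
theorem IsRegularCurve.isClosed_L2Normal (hf : IsRegularCurve 5 f) :
    IsClosed (L2Normal f : Set (L2 f)) := by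
  have : (L2Normal f : Set (L2 f)) = {u | hf.normalProj u = u} := by
    ext u
    rw [SetLike.mem_coe, hf.mem_L2Normal_iff, mem_ofPred_eq]
    constructor
    · intro h
      refine hf.ext_ae ?_
      filter_upwards [h, hf.coe_normalProj u] with x h1 h2
      rw [h2, real_inner_comm, h1, zero_smul, sub_zero]
    · intro h
      filter_upwards [hf.coe_normalProj u, ae_restrict_mem measurableSet_Icc] with x h1 h2
      have h3 : (inner ℝ (unitTangent f x) (unitTangent f x) : ℝ) = 1 := by
        rw [real_inner_self_eq_norm_sq, hf.norm_unitTangent h2, one_pow]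
      rw [h] at h1
      rw [h1, inner_sub_right, inner_smul_right, h3, real_inner_comm, mul_one, sub_self]
  rw [this]
  exact isClosed_eq hf.normalProj.continuous continuous_id

theorem IsRegularCurve.isClosed_H4cNormal (hf : IsRegularCurve 5 f) :
    IsClosed (H4cNormal f : Set (Sobolev f 4)) := by
  have h1 : Continuous (Sobolev.toH2 f) := by
    refine Continuous.subtype_mk ?_ _
    refine (PiLp.continuous_toLp 1 _).comp (continuous_pi fun i => ?_)
    exact (Sobolev.component f 4 _).continuous
  exact ((Submodule.isClosed_topologicalClosure _).preimage h1).inter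
    (hf.isClosed_L2Normal.preimage (Sobolev.component f 4 0).continuous)

end ElasticCurve

open ElasticCurve in
theorem mainTheorem5 (d : ℕ) (hd : 2 ≤ d) (f : ℝ → EuclideanSpace ℝ (Fin d))
    (hf : IsRegularCurve 5 f) :
    ∃ T : H4cNormal f →L[ℝ] L2Normal f,
      (∀ (φ : H4cNormal f) (ψ : L2 f),
        HasIterNablaS f 4 (Sobolev.toL2 f 4 (φ : Sobolev f 4)) ψ ↔ ψ = (T φ : L2 f)) ∧
      T.IsFredholm ∧ fredholmIndex T = 0 := by
  obtain ⟨S, hS⟩ := hf.exists_iterNablaS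
  have hrange : ∀ φ, S φ ∈ L2Normal f := fun φ => by
    obtain ⟨χ, -, h⟩ := (hS φ (S φ)).2 rfl
    exact hf.mem_L2Normal_of_hasNablaS h
  let T : H4cNormal f →L[ℝ] L2Normal f :=
    (S.codRestrict (L2Normal f) hrange).comp (H4cNormal f).subtypeL
  have hT : ∀ (φ : H4cNormal f) (ψ : L2 f),
      HasIterNablaS f 4 ((φ : Sobolev f 4).1 0) ψ ↔ ψ = (T φ : L2 f) := fun φ ψ => hS φ ψ
  have hbij : Function.Bijective T := by
    constructor
    · rw [injective_iff_map_eq_zero]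
      intro φ hφ
      refine Subtype.ext (hf.eq_zero_of_iterNablaS_eq_zero φ.2 ((hT φ 0).2 ?_))
      rw [hφ]; rfl
    · intro g
      obtain ⟨φ, hφ, h⟩ := hf.exists_iterNablaS_eq g.2
      exact ⟨⟨φ, hφ⟩, Subtype.ext ((hT ⟨φ, hφ⟩ g).1 h).symm⟩
  have := hf.completeSpace_sobolev 4
  have : CompleteSpace (H4cNormal f) := hf.isClosed_H4cNormal.completeSpace_coe
  have : CompleteSpace (L2Normal f) := hf.isClosed_L2Normal.completeSpace_coe
  have hfred := @ContinuousLinearMap.isFredholm_of_bijective (H4cNormal f) (L2Normal f) inferInstance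
    inferInstance inferInstance inferInstance inferInstance inferInstance T hbij
  exact ⟨T, hT, hfred, fredholmIndex_of_bijective T hbij⟩
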